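/- **Proposition 4.1.** Let $T>0$, let $A:[0,T]\times\mathbb R^n\to\mathbb R^n$, $B:[0,T]\times\mathbb R^n\to\mathbb R^{n\times m}$, $Q:[0,T]\times\mathbb R^n\to\mathbb R$, $S:[0,T]\times\mathbb R^n\to\mathbb R^m$, $R:[0,T]\times\mathbb R^n\to\mathbb S^m$ (symmetric matrices), $G:\mathbb R^n\to\mathbb R$, and assume the following. (H1) $A,B$ are continuous and there are $L_A,L_B,\tilde L_B>0$ such that for all $t\in[0,T]$, $x,\bar x\in\mathbb R^n$, $u\in\mathbb R^m$: $|A(t,x)-A(t,\bar x)|\le L_A|x-\bar x|$, $|B(t,x)-B(t,\bar x)|\le\tilde L_B|x-\bar x|$ and $\langle[B(t,x)-B(t,\bar x)]^T(x-\bar x),u\rangle\le L_B|x-\bar x|^2$. (H2) $Q,S,R,G$ are continuous, and there are $L,Q_0,G_0,S_0,\rho_0>0$, $\varepsilon_0\in(0,1)$ and a continuous $\rho:\mathbb R^n\to[\rho_0,\infty)$ such that for all $(t,x)\in[0,T]\times\mathbb R^n$: $R(t,x)\ge\rho(x)I$; $(1-\varepsilon_0)Q(t,x)-\frac12S(t,x)^TR(t,x)^{-1}S(t,x)\ge-L$;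 $G(x)\ge-L$; $Q(t,x)\le Q_0(1+|x|^2)$; $G(x)\le G_0(1+|x|^2)$; $|S(t,x)|\le S_0(1+|x|)$; $|A(t,x)+B(t,x)R(t,x)^{-1}S(t,x)|\le L(1+|x|)$; $|B(t,x)R(t,x)^{-1}B(t,x)^T|\le L$. (H3) $(t,x)\mapsto(A,B,Q,S,R)(t,x)$ is twice continuously differentiable on $[0,T]\times\mathbb R^n$, and $G$ is twice continuously differentiable. Differential equations are understood in the sense of Carathéodory: solutions are absolutely continuous on $[t,T]$ and satisfy the equation for a.e. $s$. For $(t,x)\in[0,T]\times\mathbb R^n$ and $u\in\mathcal U[t,T]:=L^2(t,T;\mathbb R^m)$ let $X(\cdot;t,x,u)$ solve $\dot X(s)=A(s,X(s))+B(s,X(s))u(s)$, $X(t)=x$, and, with $X=X(\cdot;t,x,u)$, put $$J(t,x;u)=\int_t^T\Big[Q(s,X(s))+\langle S(s,X(s)),u(s)\rangle+\tfrac12\langle R(s,X(s))u(s),u(s)\rangle\Big]ds+G(X(T)).$$ Let $D_uJ(t,x;u)\in\mathcal U[t,T]$ be the gradient (Fréchet derivative, identified by Riesz representation) of $u\mapsto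 J(t,x;u)$ on the Hilbert space $\mathcal U[t,T]$, and let $D_{uu}J(t,x;u)$, a bounded linear operator on $\mathcal U[t,T]$, be the Fréchet derivative of $u\mapsto D_uJ(t,x;u)$. Let $B^j$ and $\tilde B^i$ be the $j$-th column of $B$ and the $i$-th column of $B^T$, let $R^j$ be the $j$-th column of $R$, and denote Jacobians and Hessians in $x$ by the subscripts $x$ and $xx$ (for a scalar function, the subscript $x$ gives a row vector). Then for every $(t,x)\in[0,T]\times\mathbb R^n$ and $u\in\mathcal U[t,T]$ the system $$\begin{cases}\dot X=A(s,X)+B(s,X)u,\\ \dot Y=-\big[A_x(s,X)+\sum_{j=1}^m u^jB^j_x(s,X)\big]^TY-Q_x(s,X)^T-S_x(s,X)^Tu-\frac12\sum_{j,k=1}^m u^ju^kR^{jk}_x(s,X)^T,\\ X(t)=x,\qquad Y(T)=G_x(X(T))^T,\end{cases}$$ on $[t,T]$ has a unique solution $(X,Y)$, the integrand of $J(t,x;u)$ is integrable, $J(t,x;\cdot)$ is differentiable at $u$, and for a.e. $s\in[t,T]$ $$[D_uJ(t,x;u)](s)=R(s,X(s))u(s)+S(s,X(s))+B(s,X(s))^TY(s).$$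 Further, $D_uJ(t,x;\cdot)$ is differentiable at $u$ and, for every $v\in\mathcal U[t,T]$, the system $$\begin{cases}\dot X_1(s)=\mathbf A(s)X_1(s)+B(s,X(s))v(s),\\ \dot Y_1(s)=-\mathbf A_1(s)X_1(s)-\mathbf A(s)^TY_1(s)-\mathbf C(s)^Tv(s),\\ X_1(t)=0,\qquad Y_1(T)=G_{xx}(X(T))X_1(T),\end{cases}$$ on $[t,T]$ has a unique solution $(X_1,Y_1)$, and for a.e. $s\in[t,T]$ $$[D_{uu}J(t,x;u)v](s)=R(s,X(s))v(s)+B(s,X(s))^TY_1(s)+\mathbf C(s)X_1(s),$$ where, with all coefficients evaluated at $(s,X(s))$ and $u,Y$ at $s$, $$\begin{aligned}\mathbf A(s)&=A_x+\sum_{j=1}^m u^jB^j_x,\\ \mathbf A_1(s)&=\sum_{i=1}^nY^iA^i_{xx}+Q_{xx}+\frac12\sum_{j,k=1}^m u^ju^kR^{jk}_{xx}+\sum_{j=1}^m u^j\Big[\sum_{i=1}^nY^iB^{ij}_{xx}+S^j_{xx}\Big],\\ \mathbf C(s)&=\sum_{j=1}^m u^jR^j_x+S_x+\sum_{i=1}^nY^i\tilde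 B^i_x.\end{aligned}$$ -/

import Mathlib

open MeasureTheory Set
open scoped InnerProduct InnerProductSpace Gradient

/-- Euclidean space `ℝᵏ` of column vectors. -/
abbrev Rn (k : ℕ) := EuclideanSpace ℝ (Fin k)

/-- The data of an affine-quadratic problem on the horizon `[0, T]`. Matrices are identified with the
linear maps they define in the standard bases, transposes with adjoints. Only the values at times in
`[0, T]` matter. -/
structure AQProblem (n m : ℕ) where
  T : ℝ
  A : ℝ → Rn n → Rn n
  B : ℝ → Rn n → (Rn m →L[ℝ] Rn n)
  Q : ℝ → Rn n → ℝ
  S : ℝ → Rn n → Rn m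
  R : ℝ → Rn n → (Rn m →L[ℝ] Rn m)
  G : Rn n → ℝ

/-- Controls on `[t, T]` with control set `U = ℝᵐ`: the Hilbert space `L²(t, T; ℝᵐ)`. -/
noncomputable abbrev Control (m : ℕ) (t T : ℝ) : Type := Lp (Rn m) 2 (volume.restrict (Icc t T))

/-- `X` is absolutely continuous on `[t, T]` with derivative `F` almost everywhere, in integral form.
With `F r` depending on `X r` this is an ordinary differential equation in the sense of
Carathéodory. -/
def SolvesODE {k : ℕ} (t T : ℝ) (X F : ℝ → Rn k) : Prop :=
  IntervalIntegrable F volume t T ∧ ∀ s ∈ Icc t T, X s = X t + ∫ r in t..s, F r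

/-- The `j`-th standard unit vector. -/
noncomputable def unitVec {k : ℕ} (j : Fin k) : Rn k := EuclideanSpace.single j 1

/-- The Hessian `f_xx(x)`, as a linear map. -/
noncomputable def hess {k : ℕ} (f : Rn k → ℝ) (x : Rn k) : Rn k →L[ℝ] Rn k :=
  fderiv ℝ (fun y => ∇ f y) x

namespace AQProblem

variable {n m : ℕ} (P : AQProblem n m)

/-- Assumptions on the state equation, for the control set `U = ℝᵐ`. -/
structure H1 : Prop where
  contA : ContinuousOn (fun p : ℝ × Rn n => P.A p.1 p.2) (Icc 0 P.T ×ˢ univ)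
  contB : ContinuousOn (fun p : ℝ × Rn n => P.B p.1 p.2) (Icc 0 P.T ×ˢ univ)
  lipA : ∃ LA > 0, ∀ t ∈ Icc 0 P.T, ∀ x y : Rn n, ‖P.A t x - P.A t y‖ ≤ LA * ‖x - y‖
  lipB : ∃ LB > 0, ∀ t ∈ Icc 0 P.T, ∀ x y : Rn n, ‖P.B t x - P.B t y‖ ≤ LB * ‖x - y‖
  monoB : ∃ LB > 0, ∀ t ∈ Icc 0 P.T, ∀ u : Rn m, ∀ x y : Rn n,
    ⟪((P.B t x - P.B t y)†) (x - y), u⟫_ℝ ≤ LB * ‖x - y‖ ^ 2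

/-- Assumptions on the cost functional. The operator `R` is invertible by the lower bound, so that
`ContinuousLinearMap.inverse` is its inverse. -/
structure H2 : Prop where
  contQ : ContinuousOn (fun p : ℝ × Rn n => P.Q p.1 p.2) (Icc 0 P.T ×ˢ univ)
  contS : ContinuousOn (fun p : ℝ × Rn n => P.S p.1 p.2) (Icc 0 P.T ×ˢ univ)
  contR : ContinuousOn (fun p : ℝ × Rn n => P.R p.1 p.2) (Icc 0 P.T ×ˢ univ)
  contG : Continuous P.G
  symmR : ∀ t ∈ Icc 0 P.T, ∀ x, IsSelfAdjoint (P.R t x)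
  bounds : ∃ L > 0, ∃ Q₀ > 0, ∃ G₀ > 0, ∃ S₀ > 0, ∃ ε₀ ∈ Ioo (0 : ℝ) 1, ∃ ρ₀ > 0,
    ∃ ρ : Rn n → ℝ, Continuous ρ ∧ (∀ x, ρ₀ ≤ ρ x) ∧
    ∀ t ∈ Icc 0 P.T, ∀ x : Rn n,
      (∀ w : Rn m, ρ x * ‖w‖ ^ 2 ≤ ⟪P.R t x w, w⟫_ℝ) ∧
      -L ≤ (1 - ε₀) * P.Q t x - 1 / 2 * ⟪P.S t x, (P.R t x).inverse (P.S t x)⟫_ℝ ∧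
      -L ≤ P.G x ∧
      P.Q t x ≤ Q₀ * (1 + ‖x‖ ^ 2) ∧
      P.G x ≤ G₀ * (1 + ‖x‖ ^ 2) ∧
      ‖P.S t x‖ ≤ S₀ * (1 + ‖x‖) ∧
      ‖P.A t x + P.B t x ((P.R t x).inverse (P.S t x))‖ ≤ L * (1 + ‖x‖) ∧
      ‖P.B t x ∘L (P.R t x).inverse ∘L (P.B t x)†‖ ≤ L

/-- All coefficients are twice continuously differentiable (one-sided at times `0` and `T`). -/
structure H3 : Prop where
  smoothA : ContDiffOn ℝ 2 (fun p : ℝ × Rn n => P.A p.1 p.2) (Icc 0 P.T ×ˢ univ)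
  smoothB : ContDiffOn ℝ 2 (fun p : ℝ × Rn n => P.B p.1 p.2) (Icc 0 P.T ×ˢ univ)
  smoothQ : ContDiffOn ℝ 2 (fun p : ℝ × Rn n => P.Q p.1 p.2) (Icc 0 P.T ×ˢ univ)
  smoothS : ContDiffOn ℝ 2 (fun p : ℝ × Rn n => P.S p.1 p.2) (Icc 0 P.T ×ˢ univ)
  smoothR : ContDiffOn ℝ 2 (fun p : ℝ × Rn n => P.R p.1 p.2) (Icc 0 P.T ×ˢ univ)
  smoothG : ContDiff ℝ 2 P.G

/-- The `j`-th column of the matrix `B(s, x)`. -/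
noncomputable def Bcol (j : Fin m) (s : ℝ) (x : Rn n) : Rn n := P.B s x (unitVec j)

/-- The `i`-th row of the matrix `B(s, x)`, as a column vector in `ℝᵐ`. -/
noncomputable def Brow (i : Fin n) (s : ℝ) (x : Rn n) : Rn m := ((P.B s x)†) (unitVec i)

/-- The `j`-th column of the matrix `R(s, x)`. -/
noncomputable def Rcol (j : Fin m) (s : ℝ) (x : Rn n) : Rn m := P.R s x (unitVec j)

/-- The `(j, k)` entry of the matrix `R(s, x)`. -/
noncomputable def Rent (j k : Fin m) (s : ℝ) (x : Rn n) : ℝ := P.R s x (unitVec k) j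

/-- `X` solves the state equation `X' = A(s, X) + B(s, X) u(s)`, `X(t) = x`, on `[t, T]`. -/
def IsState (t : ℝ) (x : Rn n) (u : Control m t P.T) (X : ℝ → Rn n) : Prop :=
  SolvesODE t P.T X (fun s => P.A s (X s) + P.B s (X s) (u s)) ∧ X t = x

open Classical in
/-- The state trajectory `X(·; t, x, u(·))` (zero if the state equation has no solution). -/
noncomputable def state (t : ℝ) (x : Rn n) (u : Control m t P.T) : ℝ → Rn n :=
  if h : ∃ X, P.IsState t x u X then h.choose else 0

/-- The running cost along a trajectory `X` with control values `u`. -/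
noncomputable def runningCost (u : ℝ → Rn m) (X : ℝ → Rn n) (s : ℝ) : ℝ :=
  P.Q s (X s) + ⟪P.S s (X s), u s⟫_ℝ + 1 / 2 * ⟪P.R s (X s) (u s), u s⟫_ℝ

/-- The cost functional `u(·) ↦ J(t, x; u(·))`. -/
noncomputable def J (t : ℝ) (x : Rn n) (u : Control m t P.T) : ℝ :=
  (∫ s in t..P.T, P.runningCost u (P.state t x u) s) + P.G (P.state t x u P.T)

/-- The first derivative `D_u J(t, x; u(·))`, an element of `L²(t, T; ℝᵐ)` through the Riesz
representation. -/
noncomputable def DuJ (t : ℝ) (x : Rn n) (u : Control m t P.T) : Control m t P.T :=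
  ∇ (P.J t x) u

/-- The second derivative `D_uu J(t, x; u(·))`, a bounded linear operator on `L²(t, T; ℝᵐ)`. -/
noncomputable def DuuJ (t : ℝ) (x : Rn n) (u : Control m t P.T) :
    Control m t P.T →L[ℝ] Control m t P.T :=
  fderiv ℝ (P.DuJ t x) u

/-- The coefficient `𝐀(s)`. -/
noncomputable def coefA (u : ℝ → Rn m) (X : ℝ → Rn n) (s : ℝ) : Rn n →L[ℝ] Rn n :=
  fderiv ℝ (P.A s) (X s) + ∑ j, u s j • fderiv ℝ (P.Bcol j s) (X s)

/-- The coefficient `𝐀₁(s)`. -/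
noncomputable def coefA₁ (u : ℝ → Rn m) (X Y : ℝ → Rn n) (s : ℝ) : Rn n →L[ℝ] Rn n :=
  ∑ i, Y s i • hess (fun y => P.A s y i) (X s) + hess (P.Q s) (X s)
    + (1 / 2 : ℝ) • ∑ j, ∑ k, (u s j * u s k) • hess (P.Rent j k s) (X s)
    + ∑ j, u s j • (∑ i, Y s i • hess (fun y => P.Bcol j s y i) (X s)
        + hess (fun y => P.S s y j) (X s))

/-- The coefficient `𝐂(s)`. -/
noncomputable def coefC (u : ℝ → Rn m) (X Y : ℝ → Rn n) (s : ℝ) : Rn n →L[ℝ] Rn m :=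
  ∑ j, u s j • fderiv ℝ (P.Rcol j s) (X s) + fderiv ℝ (P.S s) (X s)
    + ∑ i, Y s i • fderiv ℝ (P.Brow i s) (X s)

/-- `(X, Y)` solves the decoupled forward-backward system (state and adjoint equation). -/
structure IsStateAdjoint (t : ℝ) (x : Rn n) (u : Control m t P.T) (X Y : ℝ → Rn n) : Prop where
  state : P.IsState t x u X
  adjoint : SolvesODE t P.T Y (fun s =>
    -((fderiv ℝ (P.A s) (X s) + ∑ j, u s j • fderiv ℝ (P.Bcol j s) (X s))†) (Y s)
      - ∇ (P.Q s) (X s) - ((fderiv ℝ (P.S s) (X s))†) (u s)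
      - (1 / 2 : ℝ) • ∑ j, ∑ k, (u s j * u s k) • ∇ (P.Rent j k s) (X s))
  terminal : Y P.T = ∇ P.G (X P.T)

/-- `(X₁, Y₁)` solves the linearized forward-backward system in the direction `v`. -/
structure IsLinearized (t : ℝ) (u : Control m t P.T) (X Y : ℝ → Rn n) (v : Control m t P.T)
    (X₁ Y₁ : ℝ → Rn n) : Prop where
  forward : SolvesODE t P.T X₁ (fun s => P.coefA u X s (X₁ s) + P.B s (X s) (v s))
  backward : SolvesODE t P.T Y₁ (fun s =>
    -P.coefA₁ u X Y s (X₁ s) - ((P.coefA u X s)†) (Y₁ s) - ((P.coefC u X Y s)†) (v s))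
  initial : X₁ t = 0
  terminal : Y₁ P.T = hess P.G (X P.T) (X₁ P.T)

end AQProblem

set_option linter.unusedSectionVars false

/-! The control is split into its monomials `1`, `u^j`, `u^j u^k / 2`. As functions of time they are
integrable, and with them as multipliers `q` the state equation reads `X' = ∑ q_i f_i(s, X)` and the
running cost `∑ q_i c_i(s, X)`, both linear in `q`. The map from `u` in `L²` to `q` in `L¹` is a
continuous quadratic polynomial, hence differentiable. All nonlinear dependence is left on
continuous curves, where superposition operators with `C¹` coefficients are strictly differentiable
in the sup norm (`hasStrictFDerivAt_nem`).

State and adjoint equation are Volterra equations with an integrable Lipschitz weight. They are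
uniquely solvable by contraction in an exponentially weighted norm (`existsUnique_volterra`). Their
linearizations have the same form, so the partial derivative in the unknown curve is bijective and
the implicit function theorem applies (`exists_hasStrictFDerivAt_fixedPoint`): `X` and `Y` depend
differentiably on `q`, and their derivatives are the solutions of the linearized equations.

Fubini's theorem makes forward and backward integration adjoint (`integral_inner_prim`). This
eliminates `X₁` from the derivative of the cost and leaves `∑ δ_i (c_i + ⟪f_i, Y⟫)`, which for the
monomials is `⟪R u + S + Bᵀ Y, v⟫`. The formula holds at every control, so the second derivative is
found by differentiating `R u + S + Bᵀ Y` in `L²`: it is a sum of continuous curves and of products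
of such curves with coordinates of `u`, and the product rule suffices
(`exists_hasStrictFDerivAt_costGradient`). -/

namespace CurveSpace

/-! ### Pointwise operations on spaces of continuous curves. -/

section Pointwise

variable {K E F G : Type*} [TopologicalSpace K] [CompactSpace K]
  [NormedAddCommGroup E] [NormedSpace ℝ E] [NormedAddCommGroup F] [NormedSpace ℝ F]
  [NormedAddCommGroup G] [NormedSpace ℝ G]

/-- A continuous bilinear map, applied pointwise to curves. -/
noncomputable def ptw (b : E →L[ℝ] F →L[ℝ] G) : C(K, E) →L[ℝ] C(K, F) →L[ℝ] C(K, G) :=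
  LinearMap.mkContinuous₂
    (LinearMap.mk₂ ℝ
      (fun (c : C(K, E)) (d : C(K, F)) => (⟨fun s => b (c s) (d s), by fun_prop⟩ : C(K, G)))
      (fun _ _ _ => by ext; simp) (fun _ _ _ => by ext; simp)
      (fun _ _ _ => by ext; simp) (fun _ _ _ => by ext; simp))
    ‖b‖ (fun c d => by
      refine (ContinuousMap.norm_le _ (by positivity)).2 fun s => ?_
      refine (b.le_opNorm₂ _ _).trans ?_
      gcongr
      · exact c.norm_coe_le_norm s
      · exact d.norm_coe_le_norm s)

@[simp] lemma ptw_apply (b : E →L[ℝ] F →L[ℝ] G) (c : C(K, E)) (d : C(K, F)) (s : K) :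
    ptw b c d s = b (c s) (d s) := rfl

/-- Pointwise application of a curve of operators to a curve. -/
noncomputable abbrev app : C(K, E →L[ℝ] F) →L[ℝ] C(K, E) →L[ℝ] C(K, F) :=
  ptw (ContinuousLinearMap.id ℝ (E →L[ℝ] F))

/-- Pointwise scalar multiplication of curves. -/
noncomputable abbrev smulC : C(K, ℝ) →L[ℝ] C(K, F) →L[ℝ] C(K, F) :=
  ptw (ContinuousLinearMap.lsmul ℝ ℝ)

/-- A continuous linear map, applied pointwise to curves. -/
noncomputable def ptwLin (b : E →L[ℝ] F) : C(K, E) →L[ℝ] C(K, F) :=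
  b.compLeftContinuous ℝ K

@[simp] lemma ptwLin_apply (b : E →L[ℝ] F) (c : C(K, E)) (s : K) : ptwLin b c s = b (c s) := rfl

/-- Constant curves. -/
noncomputable def constC : E →L[ℝ] C(K, E) :=
  LinearMap.mkContinuous
    { toFun := fun e => ContinuousMap.const K e, map_add' := fun _ _ => rfl
      map_smul' := fun _ _ => rfl } 1 (fun e => by
      rw [one_mul]
      exact (ContinuousMap.norm_le _ (norm_nonneg _)).2 fun s => le_rfl)

@[simp] lemma constC_apply (e : E) (s : K) : constC e s = e := rfl

/-- Evaluation of a curve. -/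
noncomputable def evalC (s : K) : C(K, E) →L[ℝ] E := ContinuousMap.evalCLM ℝ s

@[simp] lemma evalC_apply (s : K) (c : C(K, E)) : evalC s c = c s := rfl

end Pointwise

/-! ### Superposition operators in the sup norm. -/

section Nemytskii

variable {K E F : Type*} [TopologicalSpace K] [CompactSpace K]
  [NormedAddCommGroup E] [NormedSpace ℝ E] [NormedAddCommGroup F] [NormedSpace ℝ F]

/-- The superposition operator `X ↦ (s ↦ g (s, X s))`. -/
def nem (g : C(K × E, F)) (X : C(K, E)) : C(K, F) :=
  g.comp ((ContinuousMap.id K).prodMk X)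

@[simp] lemma nem_apply (g : C(K × E, F)) (X : C(K, E)) (s : K) : nem g X s = g (s, X s) := rfl

/-- For compact `K` the norm topology is the compact-open one, in which postcomposition with any
continuous map is continuous. Uniform continuity of `g` on the noncompact `K × E` is not needed. -/
lemma continuous_nem (g : C(K × E, F)) : Continuous (nem g) :=
  (ContinuousMap.continuous_postcomp g).comp
    (ContinuousMap.continuous_of_continuous_uncurry _
      (continuous_snd.prodMk (continuous_eval.comp continuous_id)))

/-- Superposition operators with `C¹` coefficients are strictly differentiable. -/
lemma hasStrictFDerivAt_nem (g : C(K × E, F)) (g' : C(K × E, E →L[ℝ] F))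
    (hg : ∀ s x, HasFDerivAt (fun y => g (s, y)) (g' (s, x)) x) (X : C(K, E)) :
    HasStrictFDerivAt (nem g) (app (nem g' X)) X := by
  refine .of_isLittleO ?_
  rw [Asymptotics.isLittleO_iff]
  intro ε hε
  obtain ⟨δ, hδ, H⟩ := Metric.continuousAt_iff.1 ((continuous_nem g').continuousAt (x := X)) ε hε
  -- The bound is uniform in `s` because a point `x` near `X s` lies on the translated curve `X + (x
  -- - X s)`, which is sup-norm close to `X`.
  have key : ∀ s, ∀ x ∈ Metric.ball (X s) δ, ‖g' (s, x) - g' (s, X s)‖ ≤ ε := by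
    intro s x hx
    have h1 : dist (X + constC (x - X s)) X < δ := by
      rw [dist_eq_norm, add_sub_cancel_left]
      refine lt_of_le_of_lt ((ContinuousMap.norm_le _ (norm_nonneg (x - X s))).2 fun r => le_rfl) ?_
      simpa [dist_eq_norm] using hx
    have h2 := (ContinuousMap.dist_apply_le_dist (f := nem g' (X + constC (x - X s)))
      (g := nem g' X) s).trans (H h1).le
    simpa [dist_eq_norm] using h2
  have hnb : Metric.ball X δ ×ˢ Metric.ball X δ ∈ nhds (X, X) :=
    prod_mem_nhds (Metric.ball_mem_nhds _ hδ) (Metric.ball_mem_nhds _ hδ)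
  filter_upwards [hnb] with p hp
  refine (ContinuousMap.norm_le _ (by positivity)).2 fun s => ?_
  have hb : ∀ Z ∈ Metric.ball X δ, Z s ∈ Metric.ball (X s) δ := fun Z hZ =>
    lt_of_le_of_lt (ContinuousMap.dist_apply_le_dist s) hZ
  have := (convex_ball (X s) δ).norm_image_sub_le_of_norm_hasFDerivWithin_le'
    (f := fun y => g (s, y)) (f' := fun x => g' (s, x)) (φ := g' (s, X s)) (C := ε)
    (fun x _ => (hg s x).hasFDerivWithinAt) (key s) (hb _ hp.2) (hb _ hp.1)
  refine this.trans ?_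
  gcongr
  exact (p.1 - p.2).norm_coe_le_norm s

end Nemytskii

/-! ### Curves, `Lᵖ` functions and primitives on `[t, T]`. -/

section Integration

variable {t T : ℝ} [hT : Fact (t ≤ T)] {E F : Type*}
  [NormedAddCommGroup E] [NormedSpace ℝ E] [NormedAddCommGroup F] [NormedSpace ℝ F]

/-- Extension of a curve on `[t, T]` to `ℝ`, constant outside `[t, T]`. -/
noncomputable def ext (c : C(Icc t T, E)) : ℝ → E := IccExtend hT.out c

lemma continuous_ext (c : C(Icc t T, E)) : Continuous (ext c) := c.continuous.Icc_extend'

lemma ext_of_mem (c : C(Icc t T, E)) {s : ℝ} (hs : s ∈ Icc t T) : ext c s = c ⟨s, hs⟩ :=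
  IccExtend_of_mem _ _ hs

lemma ext_coe (c : C(Icc t T, E)) (s : Icc t T) : ext c s = c s := ext_of_mem c s.2

lemma norm_ext_le (c : C(Icc t T, E)) (s : ℝ) : ‖ext c s‖ ≤ ‖c‖ := c.norm_coe_le_norm _

/-- The class of a curve in `Lᵖ`. -/
noncomputable def toLpC (p : ENNReal) [Fact (1 ≤ p)] :
    C(Icc t T, E) →L[ℝ] Lp E p (volume.restrict (Icc t T)) :=
  (BoundedContinuousFunction.toLp p (volume.restrict (Icc t T)) ℝ) ∘L
  LinearMap.mkContinuous
    { toFun := fun c => (BoundedContinuousFunction.ofNormedAddCommGroup (ext c) (continuous_ext c)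
          ‖c‖ (norm_ext_le c))
      map_add' := fun _ _ => rfl
      map_smul' := fun _ _ => rfl } 1 (fun c => by
      rw [one_mul]
      exact (BoundedContinuousFunction.norm_le (norm_nonneg _)).2 fun s => norm_ext_le c s)

lemma coeFn_toLpC (p : ENNReal) [Fact (1 ≤ p)] (c : C(Icc t T, E)) :
    toLpC p c =ᵐ[volume.restrict (Icc t T)] ext c :=
  BoundedContinuousFunction.coeFn_toLp p (volume.restrict (Icc t T)) ℝ _

/-- The product of a curve and a scalar `Lᵖ` function. -/
noncomputable def mulLp (p : ENNReal) [Fact (1 ≤ p)] :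
    C(Icc t T, E) →L[ℝ] Lp ℝ p (volume.restrict (Icc t T)) →L[ℝ]
      Lp E p (volume.restrict (Icc t T)) :=
  ((ContinuousLinearMap.lsmul ℝ ℝ : ℝ →L[ℝ] E →L[ℝ] E).flip.holderL
    (volume.restrict (Icc t T)) ⊤ p p) ∘L toLpC ⊤

lemma coeFn_mulLp (p : ENNReal) [Fact (1 ≤ p)] (c : C(Icc t T, E))
    (q : Lp ℝ p (volume.restrict (Icc t T))) :
    mulLp p c q =ᵐ[volume.restrict (Icc t T)] fun s => q s • ext c s := by
  have h := ((ContinuousLinearMap.lsmul ℝ ℝ : ℝ →L[ℝ] E →L[ℝ] E).flip.coeFn_holder (r := p)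
    (toLpC ⊤ c) q)
  filter_upwards [h, coeFn_toLpC ⊤ c] with s h1 h2
  rw [← h2]
  exact h1

lemma uIoc_subset_Icc (a s : Icc t T) : uIoc (a : ℝ) s ⊆ Icc t T := by
  intro r hr
  rcases mem_uIoc.1 hr with h | h
  · exact ⟨a.2.1.trans h.1.le, h.2.trans s.2.2⟩
  · exact ⟨s.2.1.trans h.1.le, h.2.trans a.2.2⟩

lemma intervalIntegrable_of_integrable {f : ℝ → E}
    (hf : Integrable f (volume.restrict (Icc t T))) (a s : Icc t T) :
    IntervalIntegrable f volume a s :=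
  intervalIntegrable_iff.2 (IntegrableOn.mono_set hf (uIoc_subset_Icc a s))

lemma intervalIntegral_congr_of_ae {f g : ℝ → E} (h : f =ᵐ[volume.restrict (Icc t T)] g)
    (a s : Icc t T) : ∫ r in a..s, f r = ∫ r in a..s, g r := by
  have h' : f =ᵐ[volume.restrict (uIoc (a : ℝ) s)] g :=
    ae_restrict_of_ae_restrict_of_subset (uIoc_subset_Icc a s) h
  exact intervalIntegral.integral_congr_ae_restrict h'

lemma norm_intervalIntegral_le {f : ℝ → E} (hf : Integrable f (volume.restrict (Icc t T)))
    (a s : Icc t T) : ‖∫ r in a..s, f r‖ ≤ ∫ r in Icc t T, ‖f r‖ := by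
  refine intervalIntegral.norm_integral_le_integral_norm_uIoc.trans ?_
  exact setIntegral_mono_set hf.norm (.of_forall fun _ => norm_nonneg _)
    (uIoc_subset_Icc a s).eventuallyLE

/-- The primitive of an integrable function that vanishes at `a`. -/
noncomputable def prim (a : Icc t T) :
    Lp E 1 (volume.restrict (Icc t T)) →L[ℝ] C(Icc t T, E) :=
  LinearMap.mkContinuous
    { toFun := fun φ =>
        ⟨fun s => ∫ r in a..s, φ r, by
          have h : ContinuousOn (fun s => ∫ r in (a : ℝ)..s, φ r) (uIcc t T) := by
            refine intervalIntegral.continuousOn_primitive_interval' (b₁ := t) (b₂ := T) ?_ ?_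
            · exact intervalIntegrable_of_integrable (L1.integrable_coeFn φ)
                ⟨t, left_mem_Icc.2 hT.out⟩ ⟨T, right_mem_Icc.2 hT.out⟩
            · rw [uIcc_of_le hT.out]; exact a.2
          rw [uIcc_of_le hT.out] at h
          exact continuousOn_iff_continuous_domRestrict.1 h⟩
      map_add' := fun φ ψ => by
        ext s
        change ∫ r in a..s, (φ + ψ) r = (∫ r in a..s, φ r) + ∫ r in a..s, ψ r
        rw [intervalIntegral_congr_of_ae (Lp.coeFn_add φ ψ)]
        exact intervalIntegral.integral_add
          (intervalIntegrable_of_integrable (L1.integrable_coeFn φ) a s)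
          (intervalIntegrable_of_integrable (L1.integrable_coeFn ψ) a s)
      map_smul' := fun k φ => by
        ext s
        change ∫ r in a..s, (k • φ) r = k • (∫ r in a..s, φ r)
        rw [intervalIntegral_congr_of_ae (Lp.coeFn_smul k φ)]
        exact intervalIntegral.integral_smul k _ } 1 (fun φ => by
      refine (ContinuousMap.norm_le _ (by positivity)).2 fun s => ?_
      rw [one_mul, L1.norm_eq_integral_norm]
      exact norm_intervalIntegral_le (L1.integrable_coeFn φ) a s)

lemma prim_apply (a : Icc t T) (φ : Lp E 1 (volume.restrict (Icc t T))) (s : Icc t T) :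
    prim a φ s = ∫ r in a..s, φ r := rfl

end Integration

/-! ### Differentiable dependence of fixed points on parameters. -/

section ImplicitFunction

variable {Q Z : Type*} [NormedAddCommGroup Q] [NormedSpace ℝ Q] [CompleteSpace Q]
  [NormedAddCommGroup Z] [NormedSpace ℝ Z] [CompleteSpace Z]

/-- A globally unique fixed point of a strictly differentiable family of maps depends
differentiably on the parameter, and its derivative solves the linearized equation. -/
lemma exists_hasStrictFDerivAt_fixedPoint {W : Q × Z → Z} {W' : Q × Z →L[ℝ] Z} {k : Q → Z} {q : Q}
    (hW : HasStrictFDerivAt W W' (q, k q)) (hk : ∀ p, W (p, k p) = k p)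
    (huniq : ∀ p z, W (p, z) = z → z = k p)
    (hbij : ∀ b, ∃! z, z = b + W' (0, z)) :
    ∃ k' : Q →L[ℝ] Z, HasStrictFDerivAt k k' q ∧ ∀ δ z, z = W' (δ, z) ↔ z = k' δ := by
  set f : Q × Z → Z := fun p => p.2 - W p with hf
  have hf' : HasStrictFDerivAt f (ContinuousLinearMap.snd ℝ Q Z - W') (q, k q) :=
    hasStrictFDerivAt_snd.sub hW
  have hb : Function.Bijective
      ((ContinuousLinearMap.snd ℝ Q Z - W') ∘L ContinuousLinearMap.inr ℝ Q Z) := by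
    rw [Function.bijective_iff_existsUnique]
    intro b
    obtain ⟨z, hz, hz'⟩ := hbij b
    refine ⟨z, ?_, fun y hy => hz' y ?_⟩
    · simp only [ContinuousLinearMap.comp_apply, sub_apply,
        ContinuousLinearMap.inr_apply, ContinuousLinearMap.coe_snd']
      exact sub_eq_of_eq_add hz
    · simp only [ContinuousLinearMap.comp_apply, sub_apply,
        ContinuousLinearMap.inr_apply, ContinuousLinearMap.coe_snd'] at hy
      exact eq_add_of_sub_eq hy
  have hinv : ((ContinuousLinearMap.snd ℝ Q Z - W') ∘L
      ContinuousLinearMap.inr ℝ Q Z).IsInvertible :=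
    ⟨ContinuousLinearEquiv.ofBijective _ (LinearMap.ker_eq_bot.2 hb.1)
      (LinearMap.range_eq_top.2 hb.2), ContinuousLinearEquiv.coe_ofBijective _ _ _⟩
  have h1 := hf'.hasStrictFDerivAt_implicitFunctionOfProdDomain hinv
  have h2 := hf'.eventually_apply_implicitFunctionOfProdDomain hinv
  -- Uniqueness is global, so the local branch of zeros must be `k`; continuity of `k` need not be
  -- known beforehand.
  have h3 : hf'.implicitFunctionOfProdDomain hinv =ᶠ[nhds q] k := by
    filter_upwards [h2] with p hp
    refine huniq p _ ?_
    have : f (q, k q) = 0 := sub_eq_zero.2 (hk q).symm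
    rw [this] at hp
    exact (sub_eq_zero.1 hp).symm
  obtain ⟨k', hk'⟩ : ∃ k', HasStrictFDerivAt k k' q := ⟨_, h1.congr_of_eventuallyEq h3⟩
  have hsol : ∀ δ, k' δ = W' (δ, k' δ) := fun δ => by
    have h5 := (hW.comp q ((hasStrictFDerivAt_id q).prodMk hk')).hasFDerivAt
    have h6 : (fun x => W (id x, k x)) = k := funext hk
    rw [h6] at h5
    exact DFunLike.congr_fun (hk'.hasFDerivAt.unique h5) δ
  refine ⟨k', hk', fun δ z => ⟨fun hz => ?_, fun hz => hz ▸ hsol δ⟩⟩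
  have hsplit : ∀ y, W' (δ, y) = W' (δ, 0) + W' (0, y) := fun y => by
    rw [← map_add, Prod.mk_add_mk, add_zero, zero_add]
  exact (hbij (W' (δ, 0))).unique (hz.trans (hsplit z)) ((hsol δ).trans (hsplit _))

end ImplicitFunction

/-! ### Volterra equations with integrable weights. -/

section Volterra

variable {t T : ℝ} [hT : Fact (t ≤ T)] {E F : Type*}
  [NormedAddCommGroup E] [NormedSpace ℝ E] [NormedAddCommGroup F] [NormedSpace ℝ F]
  {κ : Type*} [Fintype κ]

lemma integral_exp_neg_mul_abs_sub {k : ℝ} (hk : 0 < k) (s : ℝ) :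
    ∫ r, Real.exp (-(k * |s - r|)) = 2 / k := by
  rw [integral_sub_left_eq_self (fun x => Real.exp (-(k * |x|))) volume s]
  have h : ∀ x, Real.exp (-(k * |x|)) = (fun y => Real.exp (-|y|)) (k * x) := fun x => by
    simp [abs_mul, abs_of_pos hk]
  simp_rw [h]
  rw [Measure.integral_comp_mul_left (fun y => Real.exp (-|y|)),
    integral_comp_abs (f := fun x => Real.exp (-x)),
    integral_exp_neg_Ioi_zero, abs_of_pos (inv_pos.2 hk), smul_eq_mul]
  field_simp

/-- Since `ℓ` is only integrable, it is truncated at height `N`. The excess has integral below `1/4`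
for large `N` by dominated convergence, and the truncated part contributes at most `N` times the
mass `2/k` of the exponential kernel. -/
lemma exists_weight {ℓ : ℝ → ℝ} (hℓ : Integrable ℓ (volume.restrict (Icc t T)))
    (h0 : ∀ s, 0 ≤ ℓ s) :
    ∃ k > 0, ∀ s : ℝ, ∫ r in Icc t T, ℓ r * Real.exp (-(k * |s - r|)) ≤ 1 / 2 := by
  have hint : ∀ N : ℕ, Integrable (fun r => ℓ r - min (ℓ r) N) (volume.restrict (Icc t T)) := by
    intro N
    exact hℓ.sub (hℓ.inf (integrable_const _))
  have hlim : Filter.Tendsto (fun N : ℕ => ∫ r in Icc t T, (ℓ r - min (ℓ r) N)) Filter.atTop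
      (nhds (∫ r in Icc t T, (0 : ℝ))) := by
    refine tendsto_integral_of_dominated_convergence ℓ (fun N => (hint N).aestronglyMeasurable) hℓ
      (fun N => .of_forall fun r => ?_) (.of_forall fun r => ?_)
    · have h1 : 0 ≤ min (ℓ r) N := le_min (h0 r) N.cast_nonneg
      rw [Real.norm_of_nonneg (sub_nonneg.2 (min_le_left _ _))]
      linarith
    · refine tendsto_const_nhds.congr' ?_
      filter_upwards [Filter.eventually_ge_atTop ⌈ℓ r⌉₊] with N hN
      rw [min_eq_left (Nat.ceil_le.1 hN), sub_self]
  rw [integral_zero] at hlim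
  obtain ⟨N, hN⟩ := (hlim.eventually_lt_const (show (0 : ℝ) < 1 / 4 by norm_num)).exists
  -- This rate gives `N * (2 / k) ≤ 1 / 4`; the summand `1` keeps it positive for `N = 0`.
  refine ⟨8 * (N + 1), by positivity, fun s => ?_⟩
  set k : ℝ := 8 * (N + 1) with hk
  have hk0 : 0 < k := by positivity
  have hexp : Integrable (fun r => Real.exp (-(k * |s - r|))) := by
    refine .of_integral_ne_zero ?_
    rw [integral_exp_neg_mul_abs_sub hk0]
    positivity
  have hle : ∀ r, Real.exp (-(k * |s - r|)) ≤ 1 := fun r =>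
    Real.exp_le_one_iff.2 (neg_nonpos.2 (by positivity))
  calc ∫ r in Icc t T, ℓ r * Real.exp (-(k * |s - r|))
      ≤ ∫ r in Icc t T, ((ℓ r - min (ℓ r) N) + N * Real.exp (-(k * |s - r|))) := by
        refine integral_mono_of_nonneg (.of_forall fun r => by have := h0 r; positivity)
          ((hint N).add (hexp.integrableOn.const_mul _)) (.of_forall fun r => ?_)
        have h1 : 0 ≤ ℓ r - min (ℓ r) N := sub_nonneg.2 (min_le_left _ _)
        have h2 : min (ℓ r) (N : ℝ) ≤ N := min_le_right _ _
        have h3 := Real.exp_pos (-(k * |s - r|))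
        have h4 := hle r
        dsimp only
        nlinarith
    _ = (∫ r in Icc t T, (ℓ r - min (ℓ r) N)) + N * ∫ r in Icc t T, Real.exp (-(k * |s - r|)) := by
        rw [integral_add (hint N) (hexp.integrableOn.const_mul _), integral_const_mul]
    _ ≤ 1 / 4 + N * (2 / k) := by
        gcongr
        rw [← integral_exp_neg_mul_abs_sub hk0 s]
        exact setIntegral_le_integral hexp (.of_forall fun r => (Real.exp_pos _).le)
    _ ≤ 1 / 2 := by
        have : (N : ℝ) * (2 / k) ≤ 1 / 4 := by
          rw [hk, mul_div_assoc', div_le_iff₀ (by positivity)]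
          linarith
        linarith

lemma coeFn_sum_mulLp (p : ENNReal) [Fact (1 ≤ p)] (c : κ → C(Icc t T, E))
    (q : κ → Lp ℝ p (volume.restrict (Icc t T))) :
    (∑ i, mulLp p (c i) (q i) : Lp E p (volume.restrict (Icc t T))) =ᵐ[volume.restrict (Icc t T)]
      fun s => ∑ i, q i s • ext (c i) s := by
  have h : ∀ᵐ s ∂volume.restrict (Icc t T), ∀ i, mulLp p (c i) (q i) s = q i s • ext (c i) s :=
    ae_all_iff.2 fun i => coeFn_mulLp p (c i) (q i)
  filter_upwards [Lp.coeFn_finsetSum Finset.univ (fun i => mulLp p (c i) (q i)), h] with s h1 h2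
  rw [h1]
  simp [h2]

lemma integrable_sum_mul (c : κ → C(Icc t T, E))
    (q : κ → Lp ℝ 1 (volume.restrict (Icc t T))) :
    Integrable (fun s => ∑ i, q i s • ext (c i) s) (volume.restrict (Icc t T)) :=
  (L1.integrable_coeFn _).congr (coeFn_sum_mulLp 1 c q)

lemma prim_sum_mulLp (a : Icc t T) (c : κ → C(Icc t T, E))
    (q : κ → Lp ℝ 1 (volume.restrict (Icc t T))) (s : Icc t T) :
    prim a (∑ i, mulLp 1 (c i) (q i)) s = ∫ r in a..s, ∑ i, q i r • ext (c i) r :=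
  intervalIntegral_congr_of_ae (coeFn_sum_mulLp 1 c q) a s

/-- Volterra integral equations with pointwise Lipschitz coefficients and integrable weights are
uniquely solvable. -/
lemma existsUnique_volterra [CompleteSpace E] (a : Icc t T)
    (q : κ → Lp ℝ 1 (volume.restrict (Icc t T)))
    (g : κ → C(Icc t T, E) → C(Icc t T, E)) {L : ℝ} (hL : 0 ≤ L)
    (hg : ∀ i X Y s, ‖g i X s - g i Y s‖ ≤ L * ‖X s - Y s‖) (b : C(Icc t T, E)) :
    ∃! X, X = b + prim a (∑ i, mulLp 1 (g i X) (q i)) := by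
  set ℓ : ℝ → ℝ := fun r => ∑ i, |q i r| * L with hℓ
  have hℓint : Integrable ℓ (volume.restrict (Icc t T)) :=
    integrable_finsetSum _ fun i _ => (L1.integrable_coeFn (q i)).abs.mul_const L
  have hℓ0 : ∀ r, 0 ≤ ℓ r := fun r => Finset.sum_nonneg fun i _ => by positivity
  obtain ⟨k, hk, hkint⟩ := exists_weight hℓint hℓ0
  set wp : C(Icc t T, ℝ) := ⟨fun s => Real.exp (k * |(a : ℝ) - s|), by fun_prop⟩ with hwp
  set wm : C(Icc t T, ℝ) := ⟨fun s => Real.exp (-(k * |(a : ℝ) - s|)), by fun_prop⟩ with hwm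
  have hpm : ∀ X : C(Icc t T, E), smulC wp (smulC wm X) = X := fun X => by
    ext1 s
    simp [hwp, hwm, smul_smul, ← Real.exp_add]
  set W : C(Icc t T, E) → C(Icc t T, E) := fun X => b + prim a (∑ i, mulLp 1 (g i X) (q i)) with hW
  -- Conjugating `W` with the weight replaces the passage to a weighted norm: `Φ` contracts in the
  -- usual sup norm.
  set Φ : C(Icc t T, E) → C(Icc t T, E) := fun Z => smulC wm (W (smulC wp Z)) with hΦ
  have hcontr : ContractingWith (1 / 2) Φ := by
    refine ⟨by rw [← NNReal.coe_lt_coe]; norm_num, LipschitzWith.of_dist_le_mul fun X Y => ?_⟩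
    refine (ContinuousMap.dist_le (by positivity)).2 fun s => ?_
    set X' := smulC wp X
    set Y' := smulC wp Y
    have h1 : Φ X s - Φ Y s = wm s • ∫ r in a..s, ∑ i, q i r • (ext (g i X') r - ext (g i Y') r) := by
      have : ∀ r, ∑ i, q i r • (ext (g i X') r - ext (g i Y') r) =
          (∑ i, q i r • ext (g i X') r) - ∑ i, q i r • ext (g i Y') r := fun r => by
        simp [smul_sub]
      simp_rw [this]
      rw [intervalIntegral.integral_sub
        (intervalIntegrable_of_integrable (integrable_sum_mul _ q) a s)
        (intervalIntegrable_of_integrable (integrable_sum_mul _ q) a s),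
        ← prim_sum_mulLp, ← prim_sum_mulLp]
      change wm s • (b s + _) - wm s • (b s + _) = _
      rw [← smul_sub, add_sub_add_left_eq_sub]
    have hint : Integrable (fun r => ℓ r * Real.exp (-(k * |(s : ℝ) - r|)) * ‖X - Y‖)
        (volume.restrict (Icc t T)) := by
      refine Integrable.mul_const ?_ _
      refine hℓint.mul_bdd (c := 1) (by fun_prop) (.of_forall fun r => ?_)
      rw [Real.norm_of_nonneg (Real.exp_pos _).le]
      exact Real.exp_le_one_iff.2 (neg_nonpos.2 (by positivity))
    rw [dist_eq_norm, h1, ← intervalIntegral.integral_smul]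
    calc ‖∫ r in a..s, wm s • ∑ i, q i r • (ext (g i X') r - ext (g i Y') r)‖
        ≤ ∫ r in uIoc (a : ℝ) s, ‖wm s • ∑ i, q i r • (ext (g i X') r - ext (g i Y') r)‖ :=
          intervalIntegral.norm_integral_le_integral_norm_uIoc
      _ ≤ ∫ r in uIoc (a : ℝ) s, ℓ r * Real.exp (-(k * |(s : ℝ) - r|)) * ‖X - Y‖ := by
          refine integral_mono_of_nonneg (.of_forall fun r => norm_nonneg _)
            (IntegrableOn.mono_set hint (uIoc_subset_Icc a s)) ?_
          filter_upwards [ae_restrict_mem measurableSet_uIoc] with r hr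
          have hr' : r ∈ Icc t T := uIoc_subset_Icc a s hr
          have h2 : ∀ i, ‖ext (g i X') r - ext (g i Y') r‖ ≤
              L * (Real.exp (k * |(a : ℝ) - r|) * ‖X - Y‖) := fun i => by
            rw [ext_of_mem _ hr', ext_of_mem _ hr']
            refine (hg i X' Y' _).trans ?_
            gcongr
            have : X' ⟨r, hr'⟩ - Y' ⟨r, hr'⟩ = wp ⟨r, hr'⟩ • (X - Y) ⟨r, hr'⟩ :=
              (smul_sub _ _ _).symm
            rw [this, norm_smul, hwp]
            simp only [ContinuousMap.coe_mk, Real.norm_eq_abs, Real.abs_exp]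
            gcongr
            exact (X - Y).norm_coe_le_norm _
          -- As `r` lies between `a` and `s`, distances from `a` add up on either side of `a`. One
          -- argument thus covers forward and backward equations.
          have h3 : |(a : ℝ) - s| = |(a : ℝ) - r| + |(s : ℝ) - r| := by
            rcases mem_uIoc.1 hr with h | h
            · rw [abs_of_nonpos (by linarith [h.1, h.2]), abs_of_nonpos (by linarith [h.1]),
                abs_of_nonneg (by linarith [h.2])]
              ring
            · rw [abs_of_nonneg (by linarith [h.1, h.2]), abs_of_nonneg (by linarith [h.2]),
                abs_of_nonpos (by linarith [h.1])]
              ring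
          rw [norm_smul]
          calc ‖wm s‖ * ‖∑ i, q i r • (ext (g i X') r - ext (g i Y') r)‖
              ≤ Real.exp (-(k * |(a : ℝ) - s|)) *
                ∑ i, |q i r| * (L * (Real.exp (k * |(a : ℝ) - r|) * ‖X - Y‖)) := by
                rw [hwm]
                simp only [ContinuousMap.coe_mk, Real.norm_eq_abs, Real.abs_exp]
                gcongr
                refine (norm_sum_le _ _).trans (Finset.sum_le_sum fun i _ => ?_)
                rw [norm_smul, Real.norm_eq_abs]
                gcongr
                exact h2 i
            _ = ℓ r * Real.exp (-(k * |(s : ℝ) - r|)) * ‖X - Y‖ := by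
                have h4 : Real.exp (-(k * |(s : ℝ) - r|)) =
                    Real.exp (-(k * |(a : ℝ) - s|)) * Real.exp (k * |(a : ℝ) - r|) := by
                  rw [← Real.exp_add, h3]
                  congr 1
                  ring
                rw [h4, hℓ, Finset.mul_sum, Finset.sum_mul, Finset.sum_mul]
                exact Finset.sum_congr rfl fun i _ => by ring
      _ ≤ ∫ r in Icc t T, ℓ r * Real.exp (-(k * |(s : ℝ) - r|)) * ‖X - Y‖ :=
          setIntegral_mono_set hint (.of_forall fun r => by have := hℓ0 r; positivity)
            (uIoc_subset_Icc a s).eventuallyLE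
      _ ≤ 1 / 2 * ‖X - Y‖ := by
          rw [integral_mul_const]
          gcongr
          exact hkint s
      _ = _ := by rw [dist_eq_norm]; norm_num
  refine ⟨smulC wp (ContractingWith.fixedPoint Φ hcontr), ?_, fun X hX => ?_⟩
  · have := hcontr.fixedPoint_isFixedPt
    have h2 := congrArg (smulC wp) this
    exact h2.symm.trans (hpm _)
  · have hX' : Φ (smulC wm X) = smulC wm X := by
      rw [hΦ]
      dsimp only
      rw [hpm]
      exact congrArg _ hX.symm
    rw [← hcontr.fixedPoint_unique hX', hpm]

end Volterra

/-! ### Duality of forward and backward integration. -/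

section Duality

variable {t T : ℝ} [hT : Fact (t ≤ T)] {E : Type*}
  [NormedAddCommGroup E] [InnerProductSpace ℝ E]

/-- The left end point of `[t, T]`. -/
def left : Icc t T := ⟨t, left_mem_Icc.2 hT.out⟩

/-- The right end point of `[t, T]`. -/
def right : Icc t T := ⟨T, right_mem_Icc.2 hT.out⟩

lemma intervalIntegral_left_right {F : Type*} [NormedAddCommGroup F] [NormedSpace ℝ F] (f : ℝ → F) :
    ∫ r in t..T, f r = ∫ r in Icc t T, f r := by
  rw [intervalIntegral.integral_of_le hT.out, integral_Icc_eq_integral_Ioc]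

/-- Forward and backward integration are adjoint up to the sign. -/
lemma integral_inner_prim [CompleteSpace E] (φ ψ : Lp E 1 (volume.restrict (Icc t T))) :
    ∫ s in Icc t T, ⟪ext (prim left φ) s, ψ s⟫_ℝ =
      -∫ s in Icc t T, ⟪φ s, ext (prim right ψ) s⟫_ℝ := by
  have hφ := L1.integrable_coeFn φ
  have hψ := L1.integrable_coeFn ψ
  -- Both sides are the integral of `⟪φ r, ψ s⟫` over the triangle `r ≤ s`. The minus sign comes
  -- from integrating from `T` down to `r`.
  have hmeas : MeasurableSet {p : ℝ × ℝ | p.2 ≤ p.1} := measurableSet_le measurable_snd measurable_fst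
  have hint : Integrable (fun p : ℝ × ℝ => {p : ℝ × ℝ | p.2 ≤ p.1}.indicator
      (fun p => ⟪φ p.2, ψ p.1⟫_ℝ) p) 
      ((volume.restrict (Icc t T)).prod (volume.restrict (Icc t T))) := by
    refine Integrable.indicator ?_ hmeas
    have h := hψ.norm.mul_prod hφ.norm
    refine h.mono ?_ (.of_forall fun p => ?_)
    · exact (hφ.aestronglyMeasurable.comp_snd).inner (hψ.aestronglyMeasurable.comp_fst)
    · rw [norm_mul, norm_norm, norm_norm, mul_comm]
      exact norm_inner_le_norm _ _
  have hswap := integral_integral_swap (f := fun s r => {p : ℝ × ℝ | p.2 ≤ p.1}.indicator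
      (fun p => ⟪φ p.2, ψ p.1⟫_ℝ) (s, r)) hint
  have h1 : ∫ s in Icc t T, ⟪ext (prim left φ) s, ψ s⟫_ℝ =
      ∫ s in Icc t T, ∫ r in Icc t T, {p : ℝ × ℝ | p.2 ≤ p.1}.indicator
      (fun p => ⟪φ p.2, ψ p.1⟫_ℝ) (s, r) := by
    refine setIntegral_congr_fun measurableSet_Icc fun s hs => ?_
    rw [ext_of_mem _ hs, prim_apply]
    have : ∀ r, {p : ℝ × ℝ | p.2 ≤ p.1}.indicator (fun p => ⟪φ p.2, ψ p.1⟫_ℝ) (s, r) =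
        (Iic s).indicator (fun r => ⟪φ r, ψ s⟫_ℝ) r := fun r => by
      simp [indicator_apply]
    simp_rw [this]
    rw [setIntegral_indicator measurableSet_Iic,
      show Icc t T ∩ Iic s = Icc t s by
        ext r; simp only [mem_inter_iff, mem_Icc, mem_Iic]
        exact ⟨fun h => ⟨h.1.1, h.2⟩, fun h => ⟨⟨h.1, h.2.trans hs.2⟩, h.2⟩⟩,
      integral_Icc_eq_integral_Ioc]
    change ⟪∫ r in t..s, φ r, ψ s⟫_ℝ = _
    rw [intervalIntegral.integral_of_le hs.1, real_inner_comm, ← integral_inner]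
    · simp_rw [real_inner_comm]
    · exact IntegrableOn.mono_set hφ (Ioc_subset_Icc_self.trans (Icc_subset_Icc_right hs.2))
  have h2 : -∫ s in Icc t T, ⟪φ s, ext (prim right ψ) s⟫_ℝ =
      ∫ r in Icc t T, ∫ s in Icc t T, {p : ℝ × ℝ | p.2 ≤ p.1}.indicator
      (fun p => ⟪φ p.2, ψ p.1⟫_ℝ) (s, r) := by
    rw [← integral_neg]
    refine setIntegral_congr_fun measurableSet_Icc fun r hr => ?_
    rw [ext_of_mem _ hr, prim_apply]
    have : ∀ s, {p : ℝ × ℝ | p.2 ≤ p.1}.indicator (fun p => ⟪φ p.2, ψ p.1⟫_ℝ) (s, r) =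
        (Ici r).indicator (fun s => ⟪φ r, ψ s⟫_ℝ) s := fun s => by
      simp [indicator_apply]
    simp_rw [this]
    rw [setIntegral_indicator measurableSet_Ici,
      show Icc t T ∩ Ici r = Icc r T by
        ext s; simp only [mem_inter_iff, mem_Icc, mem_Ici]
        exact ⟨fun h => ⟨h.2, h.1.2⟩, fun h => ⟨⟨hr.1.trans h.1, h.2⟩, h.1⟩⟩,
      integral_Icc_eq_integral_Ioc]
    change -⟪φ r, ∫ s in T..r, ψ s⟫_ℝ = _
    rw [intervalIntegral.integral_symm, intervalIntegral.integral_of_le hr.2, inner_neg_right,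
      neg_neg, ← integral_inner]
    exact IntegrableOn.mono_set hψ (Ioc_subset_Icc_self.trans (Icc_subset_Icc_left hr.1))
  rw [h1, h2, hswap]

end Duality

/-! ### Coefficients that are `C¹` in the state. -/

section Coefficients

variable {t T : ℝ} {E F : Type*}
  [NormedAddCommGroup E] [NormedSpace ℝ E] [NormedAddCommGroup F] [NormedSpace ℝ F]

/-- A time-dependent coefficient that is continuously differentiable in the state. -/
structure IsC1 (t T : ℝ) (g : ℝ → E → F) : Prop where
  cont : Continuous fun p : Icc t T × E => g p.1 p.2
  diff : ∀ s ∈ Icc t T, Differentiable ℝ (g s)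
  cont_fderiv : Continuous fun p : Icc t T × E => fderiv ℝ (g p.1) p.2

namespace IsC1

variable {g : ℝ → E → F}

/-- The superposition operator of a coefficient. -/
def nem (hg : IsC1 t T g) (X : C(Icc t T, E)) : C(Icc t T, F) := CurveSpace.nem ⟨_, hg.cont⟩ X

/-- The superposition operator of the derivative of a coefficient. -/
noncomputable def nemDeriv (hg : IsC1 t T g) (X : C(Icc t T, E)) : C(Icc t T, E →L[ℝ] F) :=
  CurveSpace.nem ⟨_, hg.cont_fderiv⟩ X

lemma nem_apply (hg : IsC1 t T g) (X : C(Icc t T, E)) (s : Icc t T) : hg.nem X s = g s (X s) := rfl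

lemma nemDeriv_apply (hg : IsC1 t T g) (X : C(Icc t T, E)) (s : Icc t T) :
    hg.nemDeriv X s = fderiv ℝ (g s) (X s) := rfl

lemma hasStrictFDerivAt_nem (hg : IsC1 t T g) (X : C(Icc t T, E)) :
    HasStrictFDerivAt hg.nem (app (hg.nemDeriv X)) X :=
  CurveSpace.hasStrictFDerivAt_nem ⟨_, hg.cont⟩ ⟨_, hg.cont_fderiv⟩
    (fun s x => (hg.diff s s.2 x).hasFDerivAt) X

end IsC1

end Coefficients

section Bilinear

variable {P E F G : Type*} [NormedAddCommGroup P] [NormedSpace ℝ P] [NormedAddCommGroup E]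
  [NormedSpace ℝ E] [NormedAddCommGroup F] [NormedSpace ℝ F] [NormedAddCommGroup G]
  [NormedSpace ℝ G] {κ : Type*} [Fintype κ]

lemma hasStrictFDerivAt_sum_bilin (b : E →L[ℝ] F →L[ℝ] G) {c : κ → P → E} {d : κ → P → F}
    {c' : κ → P →L[ℝ] E} {d' : κ → P →L[ℝ] F} {p : P}
    (hc : ∀ i, HasStrictFDerivAt (c i) (c' i) p) (hd : ∀ i, HasStrictFDerivAt (d i) (d' i) p) :
    HasStrictFDerivAt (fun r => ∑ i, b (c i r) (d i r))
      (∑ i, (b.precompR P (c i p) (d' i) + b.precompL P (c' i) (d i p))) p :=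
  HasStrictFDerivAt.fun_sum fun i _ => b.hasStrictFDerivAt_of_bilinear (hc i) (hd i)

end Bilinear

/-! ### Systems linear in the multipliers: the state and its derivative. -/

/-- Coefficients of a control problem that is linear in the control, written in terms of the
multipliers `q i`: state equation `X' = ∑ i, q i • f i (s, X)`, running cost `∑ i, q i * c i (s, X)`
and terminal cost `G`. -/
structure System (t T : ℝ) (n : ℕ) (κ : Type*) where
  f : κ → ℝ → Rn n → Rn n
  c : κ → ℝ → Rn n → ℝ
  G : Rn n → ℝ
  L : ℝ
  isC1_f : ∀ i, IsC1 t T (f i)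
  isC1_grad_f : ∀ i k, IsC1 t T (fun s x => ∇ (fun y => f i s y k) x)
  isC1_c : ∀ i, IsC1 t T (c i)
  isC1_grad_c : ∀ i, IsC1 t T (fun s x => ∇ (c i s) x)
  contDiff_G : ContDiff ℝ 2 G
  L_nonneg : 0 ≤ L
  lip_f : ∀ i, ∀ s ∈ Icc t T, ∀ x y, ‖f i s x - f i s y‖ ≤ L * ‖x - y‖

namespace System

variable {t T : ℝ} [hT : Fact (t ≤ T)] {n : ℕ} {κ : Type*} [Fintype κ] (S : System t T n κ)

/-- The multipliers. -/
abbrev Mult (t T : ℝ) (κ : Type*) := κ → Lp ℝ 1 (volume.restrict (Icc t T))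

/-- A coordinate of a curve. -/
noncomputable abbrev coordC (k : Fin n) : C(Icc t T, Rn n) →L[ℝ] C(Icc t T, ℝ) :=
  ptwLin (EuclideanSpace.proj k)

/-- The right-hand side of the state equation. -/
noncomputable def fwd (q : Mult t T κ) (X : C(Icc t T, Rn n)) :
    Lp (Rn n) 1 (volume.restrict (Icc t T)) :=
  ∑ i, mulLp 1 ((S.isC1_f i).nem X) (q i)

/-- The right-hand side of the linearized state equation. -/
noncomputable def fwdLin (q : Mult t T κ) (X : C(Icc t T, Rn n)) (δ : Mult t T κ)
    (X₁ : C(Icc t T, Rn n)) : Lp (Rn n) 1 (volume.restrict (Icc t T)) :=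
  ∑ i, mulLp 1 (app ((S.isC1_f i).nemDeriv X) X₁) (q i) +
    ∑ i, mulLp 1 ((S.isC1_f i).nem X) (δ i)

/-- The coefficients of the adjoint equation. -/
noncomputable def adjC (i : κ) (X Y : C(Icc t T, Rn n)) : C(Icc t T, Rn n) :=
  -(∑ k, smulC (coordC k Y) ((S.isC1_grad_f i k).nem X) + (S.isC1_grad_c i).nem X)

/-- The derivative of the coefficients of the adjoint equation. -/
noncomputable def adjLinC (i : κ) (X Y X₁ Y₁ : C(Icc t T, Rn n)) : C(Icc t T, Rn n) :=
  -(∑ k, (smulC (coordC k Y) (app ((S.isC1_grad_f i k).nemDeriv X) X₁) +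
      smulC (coordC k Y₁) ((S.isC1_grad_f i k).nem X)) + app ((S.isC1_grad_c i).nemDeriv X) X₁)

/-- The right-hand side of the adjoint equation. -/
noncomputable def bwd (q : Mult t T κ) (X Y : C(Icc t T, Rn n)) :
    Lp (Rn n) 1 (volume.restrict (Icc t T)) :=
  ∑ i, mulLp 1 (S.adjC i X Y) (q i)

/-- The right-hand side of the linearized adjoint equation. -/
noncomputable def bwdLin (q : Mult t T κ) (X Y : C(Icc t T, Rn n)) (δ : Mult t T κ)
    (X₁ Y₁ : C(Icc t T, Rn n)) : Lp (Rn n) 1 (volume.restrict (Icc t T)) :=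
  ∑ i, mulLp 1 (S.adjLinC i X Y X₁ Y₁) (q i) + ∑ i, mulLp 1 (S.adjC i X Y) (δ i)

lemma existsUnique_traj (x : Rn n) (q : Mult t T κ) :
    ∃! X, X = constC x + prim left (S.fwd q X) :=
  existsUnique_volterra left q (fun i => (S.isC1_f i).nem) S.L_nonneg
    (fun i _ _ s => S.lip_f i s s.2 _ _) (constC x)

/-- The solution of the state equation. -/
noncomputable def traj (x : Rn n) (q : Mult t T κ) : C(Icc t T, Rn n) :=
  (S.existsUnique_traj x q).choose

lemma traj_eq (x : Rn n) (q : Mult t T κ) :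
    S.traj x q = constC x + prim left (S.fwd q (S.traj x q)) :=
  (S.existsUnique_traj x q).choose_spec.1

lemma eq_traj {x : Rn n} {q : Mult t T κ} {X : C(Icc t T, Rn n)}
    (h : X = constC x + prim left (S.fwd q X)) : X = S.traj x q :=
  (S.existsUnique_traj x q).unique h (S.traj_eq x q)

lemma traj_left (x : Rn n) (q : Mult t T κ) : S.traj x q left = x := by
  rw [traj_eq, ContinuousMap.add_apply, prim_apply, intervalIntegral.integral_same, add_zero,
    constC_apply]

/-- Linear Volterra equations are uniquely solvable. -/
lemma existsUnique_linear_volterra {E : Type*} [NormedAddCommGroup E] [NormedSpace ℝ E]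
    [CompleteSpace E] (a : Icc t T) (q : Mult t T κ) (g : κ → C(Icc t T, E) → C(Icc t T, E))
    (M : κ → C(Icc t T, E →L[ℝ] E)) (hg : ∀ i X, g i X = app (M i) X) (b : C(Icc t T, E)) :
    ∃! X, X = b + prim a (∑ i, mulLp 1 (g i X) (q i)) := by
  refine existsUnique_volterra a q g (L := ∑ i, ‖M i‖)
    (by positivity) (fun i X Y s => ?_) b
  rw [hg, hg]
  change ‖M i s (X s) - M i s (Y s)‖ ≤ _
  rw [← map_sub]
  refine (ContinuousLinearMap.le_opNorm _ _).trans ?_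
  gcongr
  exact ((M i).norm_coe_le_norm s).trans
    (Finset.single_le_sum (f := fun i => ‖M i‖) (fun j _ => norm_nonneg (M j)) (Finset.mem_univ i))

/-- The state depends differentiably on the multipliers, and the derivative solves the linearized
state equation. -/
lemma exists_hasStrictFDerivAt_traj (x : Rn n) (q : Mult t T κ) :
    ∃ K : Mult t T κ →L[ℝ] C(Icc t T, Rn n), HasStrictFDerivAt (S.traj x) K q ∧
      ∀ δ Z, Z = prim left (S.fwdLin q (S.traj x q) δ Z) ↔ Z = K δ := by
  set X := S.traj x q
  obtain ⟨W', hW, hW'⟩ : ∃ W' : Mult t T κ × C(Icc t T, Rn n) →L[ℝ] C(Icc t T, Rn n),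
      HasStrictFDerivAt (fun p : Mult t T κ × C(Icc t T, Rn n) =>
        constC x + prim left (S.fwd p.1 p.2)) W' (q, X) ∧
      ∀ δ Z, W' (δ, Z) = prim left (S.fwdLin q X δ Z) := by
    refine ⟨_, ((prim left).hasStrictFDerivAt.comp (q, X)
      (hasStrictFDerivAt_sum_bilin (mulLp (t := t) (T := T) (E := Rn n) 1) (p := (q, X))
        (c := fun i (p : Mult t T κ × C(Icc t T, Rn n)) => (S.isC1_f i).nem p.2)
        (d := fun i p => p.1 i)
        (fun i => ((S.isC1_f i).hasStrictFDerivAt_nem X).comp (q, X) hasStrictFDerivAt_snd)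
        (fun i => ((ContinuousLinearMap.proj i).comp
          (ContinuousLinearMap.fst ℝ (Mult t T κ) C(Icc t T, Rn n))).hasStrictFDerivAt))).const_add
        (constC x), fun δ Z => ?_⟩
    rw [ContinuousLinearMap.comp_apply, fwdLin, add_comm, ← Finset.sum_add_distrib, sum_apply]
    rfl
  -- With `δ = 0` and an arbitrary inhomogeneity `b`, the linearized equation is a linear Volterra
  -- equation; this is the bijectivity required.
  obtain ⟨K, hK, hK'⟩ := exists_hasStrictFDerivAt_fixedPoint (k := S.traj x) hW
    (fun p => (S.traj_eq x p).symm) (fun p z hz => S.eq_traj hz.symm) (fun b => by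
      have := existsUnique_linear_volterra left q
        (fun i Z => app ((S.isC1_f i).nemDeriv X) Z) _ (fun i Z => rfl) b
      simp_rw [hW', fwdLin]
      simpa using this)
  refine ⟨K, hK, fun δ Z => ?_⟩
  rw [← hW']
  exact hK' δ Z

end System

/-! ### Gradients, adjoints and coordinates in Euclidean space. -/

section Gradient

variable {n : ℕ}

/-- The Riesz representation on Euclidean space, as a linear map. -/
noncomputable def riesz (n : ℕ) : (Rn n →L[ℝ] ℝ) →L[ℝ] Rn n :=
  ∑ k, (ContinuousLinearMap.apply ℝ ℝ (unitVec k : Rn n)).smulRight (unitVec k : Rn n)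

lemma riesz_apply_coord (φ : Rn n →L[ℝ] ℝ) (k : Fin n) : riesz n φ k = φ (unitVec k) := by
  simp [riesz, unitVec, Pi.single_apply]

/-- Writing `∇` as a fixed real-linear continuous map after `fderiv` lets smoothness of the
derivative pass to the gradient. -/
lemma gradient_eq_riesz (f : Rn n → ℝ) (x : Rn n) : ∇ f x = riesz n (fderiv ℝ f x) := by
  ext k
  rw [riesz_apply_coord]
  have h : ⟪∇ f x, unitVec k⟫_ℝ = fderiv ℝ f x (unitVec k) := by
    rw [gradient, InnerProductSpace.toDual_symm_apply]
  rw [← h, unitVec, EuclideanSpace.inner_single_right]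
  simp

lemma inner_gradient (f : Rn n → ℝ) (x y : Rn n) : ⟪∇ f x, y⟫_ℝ = fderiv ℝ f x y := by
  rw [gradient, InnerProductSpace.toDual_symm_apply]

lemma fderiv_coord {E : Type*} [NormedAddCommGroup E] [NormedSpace ℝ E] {f : E → Rn n} {x : E}
    (hf : DifferentiableAt ℝ f x) (k : Fin n) (y : E) :
    fderiv ℝ (fun z => f z k) x y = fderiv ℝ f x y k :=
  DFunLike.congr_fun
    (((EuclideanSpace.proj (𝕜 := ℝ) k).hasFDerivAt.comp x hf.hasFDerivAt).fderiv) y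

lemma sum_unitVec (x : Rn n) : ∑ k, x k • (unitVec k : Rn n) = x := by
  ext j
  simp [unitVec, Pi.single_apply]

/-- Connects transposed Jacobians, as in the adjoint equation of the theorem, with the gradients of
components used in `System`. -/
lemma adjoint_fderiv_apply {m : ℕ} {f : Rn n → Rn m} {x : Rn n} (hf : DifferentiableAt ℝ f x)
    (y : Rn m) : ((fderiv ℝ f x)†) y = ∑ k, y k • ∇ (fun z => f z k) x := by
  refine ext_inner_right ℝ fun z => ?_
  rw [ContinuousLinearMap.adjoint_inner_left, sum_inner]
  simp_rw [real_inner_smul_left, inner_gradient, fderiv_coord hf]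
  simp [PiLp.inner_apply, mul_comm]

lemma hasStrictFDerivAt_gradient {G : Rn n → ℝ} (hG : ContDiff ℝ 2 G) (x : Rn n) :
    HasStrictFDerivAt (fun y => ∇ G y) (hess G x) x := by
  have h : ContDiff ℝ 1 (fun y => ∇ G y) := by
    simp_rw [gradient_eq_riesz]
    exact (riesz n).contDiff.comp (hG.fderiv_right le_rfl)
  exact h.contDiffAt.hasStrictFDerivAt one_ne_zero

end Gradient

/-! ### The adjoint state and the derivative of the cost. -/

namespace System

variable {t T : ℝ} [hT : Fact (t ≤ T)] {n : ℕ} {κ : Type*} [Fintype κ] (S : System t T n κ)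

lemma norm_affine_sub_le (c : Fin n → C(Icc t T, Rn n)) (d Y Z : C(Icc t T, Rn n))
    (s : Icc t T) :
    ‖(-(∑ k, smulC (coordC k Y) (c k) + d)) s - (-(∑ k, smulC (coordC k Z) (c k) + d)) s‖ ≤
      (∑ k, ‖c k‖) * ‖Y s - Z s‖ := by
  have h : (-(∑ k, smulC (coordC k Y) (c k) + d)) s - (-(∑ k, smulC (coordC k Z) (c k) + d)) s =
      -∑ k, (Y s - Z s) k • c k s := by
    simp [ContinuousMap.sum_apply, sub_smul]
    abel
  rw [h, norm_neg, Finset.sum_mul]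
  refine (norm_sum_le _ _).trans (Finset.sum_le_sum fun k _ => ?_)
  rw [norm_smul, mul_comm]
  gcongr
  · exact (c k).norm_coe_le_norm s
  · exact PiLp.norm_apply_le _ _

/-- An affine coefficient is Lipschitz with a constant independent of `d`. With `d` the cost
gradients this solves the adjoint equation; with `d = 0` it inverts the linearization of that
equation. -/
lemma existsUnique_affine (q : Mult t T κ) (c : κ → Fin n → C(Icc t T, Rn n))
    (d : κ → C(Icc t T, Rn n)) (b : C(Icc t T, Rn n)) :
    ∃! Y, Y = b + prim right (∑ i, mulLp 1 (-(∑ k, smulC (coordC k Y) (c i k) + d i)) (q i)) := by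
  refine existsUnique_volterra right q (fun i Y => -(∑ k, smulC (coordC k Y) (c i k) + d i))
    (L := ∑ i, ∑ k, ‖c i k‖) (by positivity) (fun i Y Z s => ?_) b
  refine (norm_affine_sub_le _ _ Y Z s).trans ?_
  gcongr
  exact Finset.single_le_sum (f := fun i => ∑ k, ‖c i k‖) (fun j _ => by positivity)
    (Finset.mem_univ i)

lemma existsUnique_adj (x : Rn n) (q : Mult t T κ) :
    ∃! Y, Y = constC (∇ S.G (S.traj x q right)) + prim right (S.bwd q (S.traj x q) Y) :=
  existsUnique_affine q _ _ _

/-- The solution of the adjoint equation. -/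
noncomputable def adj (x : Rn n) (q : Mult t T κ) : C(Icc t T, Rn n) :=
  (S.existsUnique_adj x q).choose

lemma adj_eq (x : Rn n) (q : Mult t T κ) :
    S.adj x q = constC (∇ S.G (S.traj x q right)) + prim right (S.bwd q (S.traj x q) (S.adj x q)) :=
  (S.existsUnique_adj x q).choose_spec.1

lemma eq_adj {x : Rn n} {q : Mult t T κ} {Y : C(Icc t T, Rn n)}
    (h : Y = constC (∇ S.G (S.traj x q right)) + prim right (S.bwd q (S.traj x q) Y)) :
    Y = S.adj x q :=
  (S.existsUnique_adj x q).unique h (S.adj_eq x q)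

lemma exists_hasStrictFDerivAt_adjC (i : κ) (X Y : C(Icc t T, Rn n)) :
    ∃ D : C(Icc t T, Rn n) × C(Icc t T, Rn n) →L[ℝ] C(Icc t T, Rn n),
      HasStrictFDerivAt (fun p : C(Icc t T, Rn n) × C(Icc t T, Rn n) => S.adjC i p.1 p.2) D (X, Y) ∧
      ∀ X₁ Y₁, D (X₁, Y₁) = S.adjLinC i X Y X₁ Y₁ := by
  refine ⟨_, ((hasStrictFDerivAt_sum_bilin (smulC (K := Icc t T) (F := Rn n)) (p := (X, Y))
      (c := fun k (p : C(Icc t T, Rn n) × C(Icc t T, Rn n)) => coordC k p.2)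
      (d := fun k p => (S.isC1_grad_f i k).nem p.1)
      (fun k => ((coordC k).comp
        (ContinuousLinearMap.snd ℝ C(Icc t T, Rn n) C(Icc t T, Rn n))).hasStrictFDerivAt)
      (fun k => ((S.isC1_grad_f i k).hasStrictFDerivAt_nem X).comp (X, Y)
        hasStrictFDerivAt_fst)).add
      (((S.isC1_grad_c i).hasStrictFDerivAt_nem X).comp (X, Y) hasStrictFDerivAt_fst)).neg,
    fun X₁ Y₁ => ?_⟩
  rw [adjLinC, neg_apply, add_apply, sum_apply]
  rfl

lemma exists_hasStrictFDerivAt_sum_mulLp {P E : Type*} [NormedAddCommGroup P] [NormedSpace ℝ P]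
    [NormedAddCommGroup E] [NormedSpace ℝ E] {c : κ → P → C(Icc t T, E)}
    {c' : κ → P →L[ℝ] C(Icc t T, E)} {p : P} (hc : ∀ i, HasStrictFDerivAt (c i) (c' i) p)
    (d : P →L[ℝ] Mult t T κ) :
    ∃ D : P →L[ℝ] Lp E 1 (volume.restrict (Icc t T)),
      HasStrictFDerivAt (fun r => ∑ i, mulLp 1 (c i r) (d r i)) D p ∧
      ∀ v, D v = ∑ i, mulLp 1 (c' i v) (d p i) + ∑ i, mulLp 1 (c i p) (d v i) := by
  refine ⟨_, hasStrictFDerivAt_sum_bilin (mulLp (t := t) (T := T) (E := E) 1) hc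
    (fun i => ((ContinuousLinearMap.proj i).comp d).hasStrictFDerivAt), fun v => ?_⟩
  rw [add_comm (∑ i, mulLp 1 _ (d p i)), ← Finset.sum_add_distrib, sum_apply]
  rfl

/-- The adjoint state depends differentiably on the multipliers, and the derivative solves the
linearized adjoint equation. -/
lemma exists_hasStrictFDerivAt_adj (x : Rn n) (q : Mult t T κ)
    {K : Mult t T κ →L[ℝ] C(Icc t T, Rn n)} (hK : HasStrictFDerivAt (S.traj x) K q) :
    ∃ N : Mult t T κ →L[ℝ] C(Icc t T, Rn n), HasStrictFDerivAt (S.adj x) N q ∧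
      ∀ δ Z, Z = constC (hess S.G (S.traj x q right) (K δ right)) +
        prim right (S.bwdLin q (S.traj x q) (S.adj x q) δ (K δ) Z) ↔ Z = N δ := by
  set Y := S.adj x q
  choose D hD hD' using fun i => S.exists_hasStrictFDerivAt_adjC i (S.traj x q) Y
  -- The system is decoupled: the state is a known differentiable function of `q`, and only `Y` is
  -- the unknown of the fixed point problem.
  have hK' : HasStrictFDerivAt (fun p : Mult t T κ × C(Icc t T, Rn n) => S.traj x p.1)
      (K.comp (ContinuousLinearMap.fst ℝ _ _)) (q, Y) := hK.comp (q, Y) hasStrictFDerivAt_fst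
  have hXY := hK'.prodMk (hasStrictFDerivAt_snd (𝕜 := ℝ) (p := (q, Y)))
  have hc := fun i => HasStrictFDerivAt.comp
    (g := fun p : C(Icc t T, Rn n) × C(Icc t T, Rn n) => S.adjC i p.1 p.2) (q, Y) (hD i) hXY
  obtain ⟨D₁, hD₁, hD₁'⟩ : ∃ D₁ : Mult t T κ × C(Icc t T, Rn n) →L[ℝ] C(Icc t T, Rn n),
      HasStrictFDerivAt (fun p : Mult t T κ × C(Icc t T, Rn n) =>
        constC (K := Icc t T) (∇ S.G (S.traj x p.1 right))) D₁ (q, Y) ∧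
      ∀ δ Z, D₁ (δ, Z) = constC (hess S.G (S.traj x q right) (K δ right)) :=
    ⟨_, (constC (K := Icc t T) (E := Rn n)).hasStrictFDerivAt.comp (q, Y)
      ((hasStrictFDerivAt_gradient S.contDiff_G (S.traj x q right)).comp (q, Y)
        ((evalC (K := Icc t T) (E := Rn n) right).hasStrictFDerivAt.comp (q, Y) hK')),
      fun δ Z => rfl⟩
  obtain ⟨D₂, hD₂, hD₂'⟩ : ∃ D₂ : Mult t T κ × C(Icc t T, Rn n) →L[ℝ]
        Lp (Rn n) 1 (volume.restrict (Icc t T)),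
      HasStrictFDerivAt (fun p : Mult t T κ × C(Icc t T, Rn n) =>
        S.bwd p.1 (S.traj x p.1) p.2) D₂ (q, Y) ∧
      ∀ δ Z, D₂ (δ, Z) = S.bwdLin q (S.traj x q) Y δ (K δ) Z := by
    obtain ⟨D₂, hD₂, hD₂'⟩ := exists_hasStrictFDerivAt_sum_mulLp hc
      (ContinuousLinearMap.fst ℝ (Mult t T κ) C(Icc t T, Rn n))
    refine ⟨D₂, hD₂, fun δ Z => ?_⟩
    rw [hD₂', bwdLin]
    simp_rw [← hD']
    rfl
  have hW := hD₁.add ((prim right).hasStrictFDerivAt.comp (q, Y) hD₂)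
  have hW' : ∀ δ Z, (D₁ + (prim right).comp D₂) (δ, Z) =
      constC (hess S.G (S.traj x q right) (K δ right)) +
        prim right (S.bwdLin q (S.traj x q) Y δ (K δ) Z) := fun δ Z => by
    rw [add_apply, ContinuousLinearMap.comp_apply, hD₁', hD₂']
  -- In the direction `(0, Z)` one has `K 0 = 0`, so only the terms linear in `Z` remain.
  obtain ⟨N, hN, hN'⟩ := exists_hasStrictFDerivAt_fixedPoint (k := S.adj x) hW
    (fun p => (S.adj_eq x p).symm) (fun p z hz => S.eq_adj hz.symm) (fun b => by
      have := existsUnique_affine q (fun i k => (S.isC1_grad_f i k).nem (S.traj x q)) 0 b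
      simp_rw [hW', bwdLin, adjLinC]
      simpa using this)
  refine ⟨N, hN, fun δ Z => ?_⟩
  rw [← hW']
  exact hN' δ Z

/-- The cost as a function of the multipliers. -/
noncomputable def cost (x : Rn n) (q : Mult t T κ) : ℝ :=
  prim left (∑ i, mulLp 1 ((S.isC1_c i).nem (S.traj x q)) (q i)) right + S.G (S.traj x q right)

lemma coeFn_fwd (q : Mult t T κ) (X : C(Icc t T, Rn n)) :
    S.fwd q X =ᵐ[volume.restrict (Icc t T)] fun s => ∑ i, q i s • S.f i s (ext X s) := by
  filter_upwards [coeFn_sum_mulLp 1 (fun i => (S.isC1_f i).nem X) q,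
    ae_restrict_mem measurableSet_Icc] with s h hs
  rw [fwd, h]
  simp_rw [ext_of_mem _ hs]
  rfl

lemma coeFn_fwdLin (q : Mult t T κ) (X : C(Icc t T, Rn n)) (δ : Mult t T κ)
    (X₁ : C(Icc t T, Rn n)) :
    S.fwdLin q X δ X₁ =ᵐ[volume.restrict (Icc t T)] fun s =>
      ∑ i, q i s • fderiv ℝ (S.f i s) (ext X s) (ext X₁ s) +
        ∑ i, δ i s • S.f i s (ext X s) := by
  filter_upwards [coeFn_sum_mulLp 1 (fun i => app ((S.isC1_f i).nemDeriv X) X₁) q,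
    coeFn_sum_mulLp 1 (fun i => (S.isC1_f i).nem X) δ, Lp.coeFn_add
      (∑ i, mulLp 1 (app ((S.isC1_f i).nemDeriv X) X₁) (q i))
      (∑ i, mulLp 1 ((S.isC1_f i).nem X) (δ i)),
    ae_restrict_mem measurableSet_Icc] with s h h' ha hs
  rw [fwdLin, ha, Pi.add_apply, h, h']
  simp_rw [ext_of_mem _ hs]
  rfl

lemma adjC_apply (i : κ) (X Y : C(Icc t T, Rn n)) (s : Icc t T) :
    S.adjC i X Y s =
      -(∑ k, Y s k • ∇ (fun y => S.f i s y k) (X s) + ∇ (S.c i s) (X s)) := by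
  simp [adjC, ContinuousMap.sum_apply, IsC1.nem_apply]

lemma adjLinC_apply (i : κ) (X Y X₁ Y₁ : C(Icc t T, Rn n)) (s : Icc t T) :
    S.adjLinC i X Y X₁ Y₁ s =
      -(∑ k, (Y s k • hess (fun y => S.f i s y k) (X s) (X₁ s) +
        Y₁ s k • ∇ (fun y => S.f i s y k) (X s)) + hess (S.c i s) (X s) (X₁ s)) := by
  simp [adjLinC, ContinuousMap.sum_apply, IsC1.nem_apply, IsC1.nemDeriv_apply, hess]

lemma coeFn_bwd (q : Mult t T κ) (X Y : C(Icc t T, Rn n)) :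
    S.bwd q X Y =ᵐ[volume.restrict (Icc t T)] fun s => -∑ i, q i s •
      (∑ k, ext Y s k • ∇ (fun y => S.f i s y k) (ext X s) + ∇ (S.c i s) (ext X s)) := by
  filter_upwards [coeFn_sum_mulLp 1 (fun i => S.adjC i X Y) q,
    ae_restrict_mem measurableSet_Icc] with s h hs
  rw [bwd, h]
  simp_rw [ext_of_mem _ hs, adjC_apply, smul_neg, Finset.sum_neg_distrib]

lemma coeFn_bwdLin (q : Mult t T κ) (X Y : C(Icc t T, Rn n)) (δ : Mult t T κ)
    (X₁ Y₁ : C(Icc t T, Rn n)) :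
    S.bwdLin q X Y δ X₁ Y₁ =ᵐ[volume.restrict (Icc t T)] fun s =>
      -(∑ i, q i s • (∑ k, (ext Y s k • hess (fun y => S.f i s y k) (ext X s) (ext X₁ s) +
          ext Y₁ s k • ∇ (fun y => S.f i s y k) (ext X s)) +
          hess (S.c i s) (ext X s) (ext X₁ s)) +
        ∑ i, δ i s • (∑ k, ext Y s k • ∇ (fun y => S.f i s y k) (ext X s) +
          ∇ (S.c i s) (ext X s))) := by
  filter_upwards [coeFn_sum_mulLp 1 (fun i => S.adjLinC i X Y X₁ Y₁) q,
    coeFn_sum_mulLp 1 (fun i => S.adjC i X Y) δ, Lp.coeFn_add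
      (∑ i, mulLp 1 (S.adjLinC i X Y X₁ Y₁) (q i)) (∑ i, mulLp 1 (S.adjC i X Y) (δ i)),
    ae_restrict_mem measurableSet_Icc] with s h h' ha hs
  rw [bwdLin, ha, Pi.add_apply, h, h']
  simp_rw [ext_of_mem _ hs, adjC_apply, adjLinC_apply, smul_neg, Finset.sum_neg_distrib]
  rw [neg_add]

lemma integrable_inner_ext {E : Type*} [NormedAddCommGroup E] [InnerProductSpace ℝ E]
    (X : C(Icc t T, E)) (φ : Lp E 1 (volume.restrict (Icc t T))) :
    Integrable (fun s => ⟪ext X s, φ s⟫_ℝ) (volume.restrict (Icc t T)) :=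
  (innerSL ℝ).integrable_of_bilin_of_bdd_left ‖X‖ (continuous_ext X).aestronglyMeasurable
    (.of_forall fun s => norm_ext_le X s) (L1.integrable_coeFn φ)

/-- The derivative of the cost in terms of the adjoint state. -/
lemma exists_hasStrictFDerivAt_cost (x : Rn n) (q : Mult t T κ) :
    ∃ D : Mult t T κ →L[ℝ] ℝ, HasStrictFDerivAt (S.cost x) D q ∧
      ∀ δ, D δ = ∫ s in Icc t T, ∑ i, δ i s * (S.c i s (ext (S.traj x q) s) +
        ⟪S.f i s (ext (S.traj x q) s), ext (S.adj x q) s⟫_ℝ) := by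
  obtain ⟨K, hK, hK'⟩ := S.exists_hasStrictFDerivAt_traj x q
  set X := S.traj x q with hX
  set Y := S.adj x q with hY
  obtain ⟨D, hD, hD'⟩ : ∃ D : Mult t T κ →L[ℝ] ℝ, HasStrictFDerivAt (S.cost x) D q ∧
      ∀ δ, D δ = prim left (∑ i, (mulLp 1 ((S.isC1_c i).nem X) (δ i) +
        mulLp 1 (app ((S.isC1_c i).nemDeriv X) (K δ)) (q i))) right +
        fderiv ℝ S.G (X right) (K δ right) := by
    refine ⟨_, ((evalC (K := Icc t T) (E := ℝ) right).hasStrictFDerivAt.comp q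
      ((prim (E := ℝ) left).hasStrictFDerivAt.comp q
      (hasStrictFDerivAt_sum_bilin (mulLp (t := t) (T := T) (E := ℝ) 1) (p := q)
        (c := fun i (p : Mult t T κ) => (S.isC1_c i).nem (S.traj x p))
        (d := fun i p => p i)
        (fun i => ((S.isC1_c i).hasStrictFDerivAt_nem X).comp q hK)
        (fun i => (ContinuousLinearMap.proj (R := ℝ)
          (φ := fun _ : κ => Lp ℝ 1 (volume.restrict (Icc t T))) i).hasStrictFDerivAt)))).add
      ((S.contDiff_G.contDiffAt.hasStrictFDerivAt two_ne_zero).comp q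
        ((evalC (K := Icc t T) right).hasStrictFDerivAt.comp q hK)), fun δ => ?_⟩
    rw [add_apply, ContinuousLinearMap.comp_apply, ContinuousLinearMap.comp_apply, sum_apply]
    rfl
  refine ⟨D, hD, fun δ => ?_⟩
  set X₁ := K δ with hX₁
  set φ := S.fwdLin q X δ X₁ with hφ
  set ψ := S.bwd q X Y with hψ
  have hX₁' : X₁ = prim left φ := (hK' δ X₁).2 rfl
  -- Since `prim right ψ` is `Y` minus its terminal value, duality expresses the terminal term `G_x
  -- X₁(T)` by integrals of `⟪Y, φ⟫` and `⟪X₁, ψ⟫`.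
  have hdual := integral_inner_prim φ ψ
  rw [← hX₁'] at hdual
  have hYψ : prim right ψ = Y - constC (∇ S.G (X right)) := eq_sub_of_add_eq' (S.adj_eq x q).symm
  have hY1 : ∫ s in Icc t T, ⟪φ s, ext (prim right ψ) s⟫_ℝ =
      (∫ s in Icc t T, ⟪ext Y s, φ s⟫_ℝ) - fderiv ℝ S.G (X right) (X₁ right) := by
    have h1 : ∀ s, ⟪φ s, ext (prim right ψ) s⟫_ℝ =
        ⟪ext Y s, φ s⟫_ℝ - ⟪∇ S.G (X right), φ s⟫_ℝ := fun s => by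
      rw [hYψ, real_inner_comm, ← inner_sub_left]
      rfl
    simp_rw [h1]
    refine (integral_sub (integrable_inner_ext Y φ)
      (integrable_inner_ext (constC (∇ S.G (X right))) φ)).trans ?_
    change _ - ∫ s in Icc t T, ⟪∇ S.G (X right), φ s⟫_ℝ = _
    rw [integral_inner (L1.integrable_coeFn φ), inner_gradient, hX₁', prim_apply]
    congr 3
    exact (intervalIntegral_left_right _).symm
  rw [hY1] at hdual
  rw [hD', Finset.sum_add_distrib, map_add, ContinuousMap.add_apply, prim_sum_mulLp,
    prim_sum_mulLp]
  have e1 : ∀ g : ℝ → ℝ, ∫ r in ((left : Icc t T) : ℝ)..((right : Icc t T) : ℝ), g r =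
    ∫ r in Icc t T, g r := fun g => intervalIntegral_left_right (t := t) (T := T) g
  have i1 : Integrable (fun s => ∑ i, δ i s • ext ((S.isC1_c i).nem X) s +
      ∑ i, q i s • ext (app ((S.isC1_c i).nemDeriv X) X₁) s) (volume.restrict (Icc t T)) :=
    (integrable_sum_mul _ _).add (integrable_sum_mul _ _)
  have i2 : Integrable (fun s => ⟪ext Y s, φ s⟫_ℝ + ⟪ext X₁ s, ψ s⟫_ℝ)
      (volume.restrict (Icc t T)) := (integrable_inner_ext Y φ).add (integrable_inner_ext X₁ ψ)
  rw [e1, e1, show fderiv ℝ S.G (X right) (X₁ right) = (∫ s in Icc t T, ⟪ext Y s, φ s⟫_ℝ) +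
    ∫ s in Icc t T, ⟪ext X₁ s, ψ s⟫_ℝ by linarith,
    ← integral_add (integrable_inner_ext Y φ) (integrable_inner_ext X₁ ψ),
    ← integral_add (integrable_sum_mul _ _) (integrable_sum_mul _ _),
    ← integral_add i1 i2]
  -- Pointwise, `⟪X₁, ψ⟫` cancels every term carrying a `q i`, by the choice of the adjoint
  -- equation. What remains is linear in `δ` and free of `X₁`.
  refine integral_congr_ae ?_
  filter_upwards [S.coeFn_fwdLin q X δ X₁, S.coeFn_bwd q X Y,
    ae_restrict_mem measurableSet_Icc] with s h1 h2 hs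
  rw [h1, h2]
  simp_rw [ext_of_mem _ hs]
  set s' : Icc t T := ⟨s, hs⟩
  simp only [IsC1.nem_apply, IsC1.nemDeriv_apply, ptw_apply, ContinuousLinearMap.id_apply,
    smul_eq_mul, inner_add_right, inner_neg_right, inner_sum, real_inner_smul_right]
  have h3 : ∀ i, ∑ k, Y s' k * ⟪X₁ s', ∇ (fun y => S.f i s y k) (X s')⟫_ℝ =
      ⟪Y s', fderiv ℝ (S.f i s) (X s') (X₁ s')⟫_ℝ := fun i => by
    simp_rw [real_inner_comm _ (X₁ s'), inner_gradient,
      fderiv_coord ((S.isC1_f i).diff s hs _)]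
    simp [PiLp.inner_apply, mul_comm]
  have h4 : ∀ i, ⟪X₁ s', ∇ (S.c i s) (X s')⟫_ℝ = fderiv ℝ (S.c i s) (X s') (X₁ s') := fun i => by
    rw [real_inner_comm, inner_gradient]
  simp_rw [h3, h4, mul_add, Finset.sum_add_distrib, real_inner_comm (Y s')]
  ring

end System

/-! ### From joint smoothness on a closed time slab to `C¹` coefficients. -/

section Smoothness

variable {E F : Type*} [NormedAddCommGroup E] [NormedSpace ℝ E] [NormedAddCommGroup F]
  [NormedSpace ℝ F] {g : ℝ → E → F} {b : ℝ}

/-- The slab contains the whole slice at time `s`, so a derivative within the slab restricts to a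
full derivative in `x`, also at the end times. -/
lemma hasFDerivAt_of_contDiffOn (hg : ContDiffOn ℝ 1 (fun p : ℝ × E => g p.1 p.2)
    (Icc 0 b ×ˢ univ)) {s : ℝ} (hs : s ∈ Icc 0 b) (x : E) :
    HasFDerivAt (g s) ((fderivWithin ℝ (fun p : ℝ × E => g p.1 p.2) (Icc 0 b ×ˢ univ) (s, x)).comp
      (ContinuousLinearMap.inr ℝ ℝ E)) x := by
  have h1 := ((hg.differentiableOn one_ne_zero) (s, x) ⟨hs, mem_univ x⟩).hasFDerivWithinAt
  have h2 : HasFDerivWithinAt (fun y : E => ((s, y) : ℝ × E)) (ContinuousLinearMap.inr ℝ ℝ E)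
      univ x := (hasFDerivAt_prodMk_right s x).hasFDerivWithinAt
  exact hasFDerivWithinAt_univ.1 (h1.comp x h2 fun y _ => ⟨hs, mem_univ y⟩)

lemma contDiffOn_fderiv (hb : 0 < b) (hg : ContDiffOn ℝ 2 (fun p : ℝ × E => g p.1 p.2)
    (Icc 0 b ×ˢ univ)) :
    ContDiffOn ℝ 1 (fun p : ℝ × E => fderiv ℝ (g p.1) p.2) (Icc 0 b ×ˢ univ) := by
  have h := hg.fderivWithin (m := 1) ((uniqueDiffOn_Icc hb).prod uniqueDiffOn_univ) le_rfl
  refine (((ContinuousLinearMap.compL ℝ E (ℝ × E) F).flip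
    (ContinuousLinearMap.inr ℝ ℝ E)).contDiff.comp_contDiffOn h).congr fun p hp => ?_
  exact (hasFDerivAt_of_contDiffOn (hg.of_le one_le_two) hp.1 p.2).fderiv

lemma contDiffOn_gradient {n : ℕ} {g : ℝ → Rn n → ℝ} (hb : 0 < b)
    (hg : ContDiffOn ℝ 2 (fun p : ℝ × Rn n => g p.1 p.2) (Icc 0 b ×ˢ univ)) :
    ContDiffOn ℝ 1 (fun p : ℝ × Rn n => ∇ (g p.1) p.2) (Icc 0 b ×ˢ univ) := by
  simp_rw [gradient_eq_riesz]
  exact (riesz n).contDiff.comp_contDiffOn (contDiffOn_fderiv hb hg)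

/-- Derivatives are taken on `[0, b]` and only then restricted to `[t, b]`, which may be a single
point, where derivatives within the set would not be unique. -/
lemma isC1_of_contDiffOn (hb : 0 < b) {t : ℝ} (ht : t ∈ Icc 0 b)
    (hg : ContDiffOn ℝ 1 (fun p : ℝ × E => g p.1 p.2) (Icc 0 b ×ˢ univ)) : IsC1 t b g := by
  have hmem : ∀ p : Icc t b × E, ((p.1 : ℝ), p.2) ∈ Icc 0 b ×ˢ (univ : Set E) := fun p =>
    ⟨⟨ht.1.trans p.1.2.1, p.1.2.2⟩, mem_univ _⟩
  have hc : Continuous fun p : Icc t b × E => ((p.1 : ℝ), p.2) := by fun_prop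
  refine ⟨hg.continuousOn.comp_continuous hc hmem, fun s hs x =>
    (hasFDerivAt_of_contDiffOn hg ⟨ht.1.trans hs.1, hs.2⟩ x).differentiableAt, ?_⟩
  have h := (hg.fderivWithin (m := 0) ((uniqueDiffOn_Icc hb).prod uniqueDiffOn_univ)
    (by norm_num)).continuousOn.comp_continuous hc hmem
  have h' := ((ContinuousLinearMap.compL ℝ E (ℝ × E) F).flip
    (ContinuousLinearMap.inr ℝ ℝ E)).continuous.comp h
  refine h'.congr fun p => ?_
  exact (hasFDerivAt_of_contDiffOn hg (hmem p).1 p.2).fderiv.symm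

end Smoothness

/-! ### Carathéodory solutions and integral equations for curves. -/

section ODE

variable {t T : ℝ} [hT : Fact (t ≤ T)] {k : ℕ}

lemma solvesODE_ext {F : ℝ → Rn k} {e : Rn k} {a : Icc t T} {X : C(Icc t T, Rn k)}
    {φ : Lp (Rn k) 1 (volume.restrict (Icc t T))} (hX : X = constC e + prim a φ)
    (hF : φ =ᵐ[volume.restrict (Icc t T)] F) : SolvesODE t T (ext X) F := by
  have hint := L1.integrable_coeFn φ
  refine ⟨intervalIntegrable_of_integrable (hint.congr hF) left right, fun s hs => ?_⟩
  have ht : t ∈ Icc t T := left_mem_Icc.2 hT.out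
  have h1 : ∀ r : Icc t T, X r = e + ∫ z in a..r, φ z := fun r => DFunLike.congr_fun hX r
  have h2 := intervalIntegral_congr_of_ae hF ⟨t, ht⟩ ⟨s, hs⟩
  rw [ext_of_mem _ hs, ext_of_mem _ ht, h1, h1, ← h2, add_assoc,
    intervalIntegral.integral_add_adjacent_intervals
      (intervalIntegrable_of_integrable hint a ⟨t, ht⟩)
      (intervalIntegrable_of_integrable hint ⟨t, ht⟩ ⟨s, hs⟩)]

/-- The class `φ` is left free so that it can be a right-hand side built from `X'` itself, and the
base point `a` so that it can be either end of the interval. -/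
lemma exists_curve_of_solvesODE {X F : ℝ → Rn k} (h : SolvesODE t T X F) :
    ∃ X' : C(Icc t T, Rn k), EqOn X (ext X') (Icc t T) ∧
      ∀ (φ : Lp (Rn k) 1 (volume.restrict (Icc t T))), φ =ᵐ[volume.restrict (Icc t T)] F →
        ∀ a, X' = constC (X' a) + prim a φ := by
  have hF : Integrable F (volume.restrict (Icc t T)) :=
    (integrableOn_Icc_iff_integrableOn_Ioc).2
      ((intervalIntegrable_iff_integrableOn_Ioc_of_le hT.out).1 h.1)
  set ψ : Lp (Rn k) 1 (volume.restrict (Icc t T)) := hF.toL1 F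
  have hψ : ψ =ᵐ[volume.restrict (Icc t T)] F := hF.coeFn_toL1
  refine ⟨constC (X t) + prim left ψ, fun s hs => ?_, fun φ hφ a => ?_⟩
  · rw [ext_of_mem _ hs, h.2 s hs]
    exact congrArg _ (intervalIntegral_congr_of_ae hψ left ⟨s, hs⟩).symm
  · have : φ = ψ := Lp.ext (hφ.trans hψ.symm)
    rw [this]
    have hint := L1.integrable_coeFn ψ
    ext1 s
    change X t + ∫ r in (left : Icc t T)..s, ψ r =
      (X t + ∫ r in (left : Icc t T)..a, ψ r) + ∫ r in a..s, ψ r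
    rw [add_assoc, intervalIntegral.integral_add_adjacent_intervals
      (intervalIntegrable_of_integrable hint left a) (intervalIntegrable_of_integrable hint a s)]

end ODE

/-! ### Monomials of the control as multipliers. -/

/-- Indices of the monomials of degree at most two in the control. -/
abbrev Idx (m : ℕ) := Unit ⊕ Fin m ⊕ Fin m × Fin m

lemma sum_idx {m : ℕ} {M : Type*} [AddCommMonoid M] (F : Idx m → M) :
    ∑ i, F i = F (.inl ()) + (∑ j, F (.inr (.inl j)) + ∑ j, ∑ k, F (.inr (.inr (j, k)))) := by
  rw [Fintype.sum_sum_type, Fintype.sum_sum_type, Fintype.sum_prod_type]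
  simp

/-- The values of the monomials in the control. -/
noncomputable def mono {m : ℕ} (w : Rn m) : Idx m → ℝ :=
  Sum.elim (fun _ => 1) (Sum.elim (fun j => w j) (fun p => 1 / 2 * (w p.1 * w p.2)))

/-- The derivatives of the monomials in the control. -/
noncomputable def monoDeriv {m : ℕ} (w z : Rn m) : Idx m → ℝ :=
  Sum.elim (fun _ => 0) (Sum.elim (fun j => z j)
    (fun p => 1 / 2 * (w p.1 * z p.2 + z p.1 * w p.2)))

section Multipliers

variable {t T : ℝ} [hT : Fact (t ≤ T)] {m : ℕ}

/-- The product of two coordinates of square integrable functions. -/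
noncomputable def coordMul (j k : Fin m) : Control m t T →L[ℝ] Control m t T →L[ℝ]
    Lp ℝ 1 (volume.restrict (Icc t T)) :=
  (((ContinuousLinearMap.mul ℝ ℝ).bilinearComp (EuclideanSpace.proj j : Rn m →L[ℝ] ℝ)
    (EuclideanSpace.proj k : Rn m →L[ℝ] ℝ))).holderL (volume.restrict (Icc t T)) 2 2 1

lemma coeFn_coordMul (j k : Fin m) (u v : Control m t T) :
    coordMul j k u v =ᵐ[volume.restrict (Icc t T)] fun s => u s j * v s k :=
  ContinuousLinearMap.coeFn_holder _ u v

/-- A coordinate of a square integrable function, as an integrable function. -/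
noncomputable def coordL1 (j : Fin m) : Control m t T →L[ℝ] Lp ℝ 1 (volume.restrict (Icc t T)) :=
  -- Hölder's inequality against the constant `1` realizes the inclusion of `L²` in `L¹`.
  ((((ContinuousLinearMap.mul ℝ ℝ).bilinearComp (EuclideanSpace.proj j : Rn m →L[ℝ] ℝ)
    (ContinuousLinearMap.id ℝ ℝ))).holderL (volume.restrict (Icc t T)) 2 2 1).flip
    (toLpC 2 (constC 1))

lemma coeFn_coordL1 (j : Fin m) (u : Control m t T) :
    coordL1 j u =ᵐ[volume.restrict (Icc t T)] fun s => u s j := by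
  have h := ContinuousLinearMap.coeFn_holder (r := 1)
    (((ContinuousLinearMap.mul ℝ ℝ).bilinearComp (EuclideanSpace.proj j : Rn m →L[ℝ] ℝ)
    (ContinuousLinearMap.id ℝ ℝ))) u (toLpC 2 (constC 1))
  filter_upwards [h, coeFn_toLpC 2 (constC (K := Icc t T) (1 : ℝ))] with s h1 h2
  refine h1.trans ?_
  rw [h2]
  exact mul_one _

/-- A coordinate of a square integrable function. -/
noncomputable def coordL2 (j : Fin m) : Control m t T →L[ℝ] Lp ℝ 2 (volume.restrict (Icc t T)) :=
  (EuclideanSpace.proj j : Rn m →L[ℝ] ℝ).compLpL 2 (volume.restrict (Icc t T))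

lemma coeFn_coordL2 (j : Fin m) (u : Control m t T) :
    coordL2 j u =ᵐ[volume.restrict (Icc t T)] fun s => u s j :=
  ContinuousLinearMap.coeFn_compLpL _ _

/-- The multipliers given by a control. -/
noncomputable def mult (u : Control m t T) : System.Mult t T (Idx m) :=
  Sum.elim (fun _ => toLpC 1 (constC 1))
    (Sum.elim (fun j => coordL1 j u) (fun p => (1 / 2 : ℝ) • coordMul p.1 p.2 u u))

lemma coeFn_mult (u : Control m t T) :
    ∀ᵐ s ∂volume.restrict (Icc t T), ∀ i, mult u i s = mono (u s) i := by
  refine ae_all_iff.2 fun i => ?_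
  rcases i with _ | j | ⟨j, k⟩
  · exact coeFn_toLpC 1 (constC 1)
  · exact coeFn_coordL1 j u
  · filter_upwards [coeFn_coordMul j k u u, Lp.coeFn_smul (1 / 2 : ℝ) (coordMul j k u u)]
      with s h1 h2
    refine h2.trans ?_
    rw [Pi.smul_apply, h1]
    rfl

/-- By Hölder's inequality a product of two coordinates is a bounded bilinear map from `L²` to `L¹`,
so the quadratic monomials are differentiable with values in `L¹`. -/
lemma exists_hasStrictFDerivAt_mult (u : Control m t T) :
    ∃ D : Control m t T →L[ℝ] System.Mult t T (Idx m), HasStrictFDerivAt mult D u ∧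
      ∀ v, ∀ᵐ s ∂volume.restrict (Icc t T), ∀ i, D v i s = monoDeriv (u s) (v s) i := by
  have h : ∀ i, ∃ D : Control m t T →L[ℝ] Lp ℝ 1 (volume.restrict (Icc t T)),
      HasStrictFDerivAt (fun w => mult w i) D u ∧
      ∀ v, ∀ᵐ s ∂volume.restrict (Icc t T), D v s = monoDeriv (u s) (v s) i := by
    rintro (_ | j | ⟨j, k⟩)
    · refine ⟨0, hasStrictFDerivAt_const _ _, fun v => ?_⟩
      exact Lp.coeFn_zero ℝ 1 _
    · exact ⟨_, (coordL1 j).hasStrictFDerivAt, fun v => coeFn_coordL1 j v⟩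
    · refine ⟨_, ((coordMul j k).hasStrictFDerivAt_of_bilinear (hasStrictFDerivAt_id u)
        (hasStrictFDerivAt_id u)).const_smul (1 / 2 : ℝ), fun v => ?_⟩
      change ∀ᵐ s ∂volume.restrict (Icc t T),
        ((1 / 2 : ℝ) • (coordMul j k u v + coordMul j k v u) :
          Lp ℝ 1 (volume.restrict (Icc t T))) s = _
      filter_upwards [Lp.coeFn_smul (1 / 2 : ℝ) (coordMul j k u v + coordMul j k v u),
        Lp.coeFn_add (coordMul j k u v) (coordMul j k v u), coeFn_coordMul j k u v,
        coeFn_coordMul j k v u] with s h1 h2 h3 h4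
      rw [h1, Pi.smul_apply, h2, Pi.add_apply, h3, h4]
      rfl
  choose D hD hD' using h
  exact ⟨ContinuousLinearMap.pi D, hasStrictFDerivAt_pi.2 hD, fun v => ae_all_iff.2 fun i => hD' i v⟩

end Multipliers

end CurveSpace

/-! ### The affine-quadratic problem as a system. -/

namespace AQProblem

open CurveSpace

variable {n m : ℕ} (P : AQProblem n m)

/-- The coefficients of the monomials in the state equation. -/
noncomputable def drift : Idx m → ℝ → Rn n → Rn n :=
  Sum.elim (fun _ => P.A) (Sum.elim P.Bcol (fun _ _ _ => 0))

/-- The coefficients of the monomials in the running cost. -/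
noncomputable def lagrangian : Idx m → ℝ → Rn n → ℝ :=
  Sum.elim (fun _ => P.Q) (Sum.elim (fun j s x => P.S s x j) (fun p => P.Rent p.1 p.2))

variable {P}

section Smooth

lemma smooth_coord {k : ℕ} {g : ℝ → Rn n → Rn k}
    (hg : ContDiffOn ℝ 2 (fun p : ℝ × Rn n => g p.1 p.2) (Icc 0 P.T ×ˢ univ)) (i : Fin k) :
    ContDiffOn ℝ 2 (fun p : ℝ × Rn n => g p.1 p.2 i) (Icc 0 P.T ×ˢ univ) :=
  (EuclideanSpace.proj (𝕜 := ℝ) i).contDiff.comp_contDiffOn hg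

lemma H3.smooth_Bcol (h3 : P.H3) (j : Fin m) :
    ContDiffOn ℝ 2 (fun p : ℝ × Rn n => P.Bcol j p.1 p.2) (Icc 0 P.T ×ˢ univ) :=
  h3.smoothB.clm_apply contDiffOn_const

lemma H3.smooth_Rcol (h3 : P.H3) (j : Fin m) :
    ContDiffOn ℝ 2 (fun p : ℝ × Rn n => P.Rcol j p.1 p.2) (Icc 0 P.T ×ˢ univ) :=
  h3.smoothR.clm_apply contDiffOn_const

lemma H3.smooth_Rent (h3 : P.H3) (j k : Fin m) :
    ContDiffOn ℝ 2 (fun p : ℝ × Rn n => P.Rent j k p.1 p.2) (Icc 0 P.T ×ˢ univ) :=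
  smooth_coord (h3.smooth_Rcol k) j

lemma Brow_coord (i : Fin n) (j : Fin m) (s : ℝ) (x : Rn n) :
    P.Brow i s x j = P.Bcol j s x i := by
  have h : ⟪P.Brow i s x, unitVec j⟫_ℝ = ⟪unitVec i, P.Bcol j s x⟫_ℝ := by
    rw [Brow, ContinuousLinearMap.adjoint_inner_left, Bcol]
  simpa [unitVec, EuclideanSpace.inner_single_left, EuclideanSpace.inner_single_right] using h

lemma H3.smooth_Brow (h3 : P.H3) (i : Fin n) :
    ContDiffOn ℝ 2 (fun p : ℝ × Rn n => P.Brow i p.1 p.2) (Icc 0 P.T ×ˢ univ) := by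
  refine contDiffOn_euclidean.2 fun j => ?_
  simp_rw [Brow_coord]
  exact smooth_coord (h3.smooth_Bcol j) i

lemma H3.smooth_drift (h3 : P.H3) (i : Idx m) :
    ContDiffOn ℝ 2 (fun p : ℝ × Rn n => P.drift i p.1 p.2) (Icc 0 P.T ×ˢ univ) := by
  rcases i with _ | j | p
  · exact h3.smoothA
  · exact h3.smooth_Bcol j
  · exact contDiffOn_const

lemma H3.smooth_lagrangian (h3 : P.H3) (i : Idx m) :
    ContDiffOn ℝ 2 (fun p : ℝ × Rn n => P.lagrangian i p.1 p.2) (Icc 0 P.T ×ˢ univ) := by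
  rcases i with _ | j | p
  · exact h3.smoothQ
  · exact smooth_coord h3.smoothS j
  · exact h3.smooth_Rent p.1 p.2

end Smooth

lemma H1.exists_lipschitz_drift (h1 : P.H1) : ∃ L ≥ 0, ∀ i, ∀ s ∈ Icc 0 P.T, ∀ x y,
    ‖P.drift i s x - P.drift i s y‖ ≤ L * ‖x - y‖ := by
  obtain ⟨LA, hLA, hA⟩ := h1.lipA
  obtain ⟨LB, hLB, hB⟩ := h1.lipB
  refine ⟨LA + LB, by positivity, fun i s hs x y => ?_⟩
  have h0 : 0 ≤ LA * ‖x - y‖ := by positivity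
  have h0' : 0 ≤ LB * ‖x - y‖ := by positivity
  rw [add_mul]
  rcases i with _ | j | p
  · exact (hA s hs x y).trans (by linarith)
  · have h2 : P.drift (.inr (.inl j)) s x - P.drift (.inr (.inl j)) s y =
        (P.B s x - P.B s y) (unitVec j) := rfl
    rw [h2]
    have h4 := (P.B s x - P.B s y).le_opNorm (unitVec j)
    have h5 : ‖(unitVec j : Rn m)‖ = 1 := by simp [unitVec]
    rw [h5, mul_one] at h4
    exact h4.trans ((hB s hs x y).trans (by linarith))
  · simp only [drift, Sum.elim_inr, sub_self, norm_zero]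
    positivity

/-- The problem as a system that is linear in the monomials of the control. -/
noncomputable def toSystem (hT : 0 < P.T) (h1 : P.H1) (h3 : P.H3) {t : ℝ} (ht : t ∈ Icc 0 P.T) :
    System t P.T n (Idx m) where
  f := P.drift
  c := P.lagrangian
  G := P.G
  L := h1.exists_lipschitz_drift.choose
  isC1_f i := isC1_of_contDiffOn hT ht ((h3.smooth_drift i).of_le one_le_two)
  isC1_grad_f i k := isC1_of_contDiffOn hT ht
    (contDiffOn_gradient (g := fun s y => P.drift i s y k) hT (smooth_coord (h3.smooth_drift i) k))
  isC1_c i := isC1_of_contDiffOn hT ht ((h3.smooth_lagrangian i).of_le one_le_two)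
  isC1_grad_c i := isC1_of_contDiffOn hT ht (contDiffOn_gradient hT (h3.smooth_lagrangian i))
  contDiff_G := h3.smoothG
  L_nonneg := h1.exists_lipschitz_drift.choose_spec.1
  lip_f i s hs := h1.exists_lipschitz_drift.choose_spec.2 i s ⟨ht.1.trans hs.1, hs.2⟩

/-- Needed wherever `u^j v^k` and `v^j u^k` are merged, and to exchange columns of `R` for rows. -/
lemma Rent_symm (h2 : P.H2) {s : ℝ} (hs : s ∈ Icc 0 P.T) (j k : Fin m) :
    P.Rent j k s = P.Rent k j s := by
  funext x
  have h : ⟪P.R s x (unitVec k), unitVec j⟫_ℝ = ⟪unitVec k, P.R s x (unitVec j)⟫_ℝ :=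
    (h2.symmR s hs x).isSymmetric _ _
  simpa [Rent, unitVec, EuclideanSpace.inner_single_left, EuclideanSpace.inner_single_right] using h

/-! ### Pointwise algebra matching monomial sums with matrix formulas. -/

section PointwiseIdentities

lemma apply_eq_sum {E : Type*} [NormedAddCommGroup E] [NormedSpace ℝ E] {k : ℕ}
    (M : Rn k →L[ℝ] E) (w : Rn k) : M w = ∑ j, w j • M (unitVec j) := by
  conv_lhs => rw [← sum_unitVec w]
  simp

lemma sum_mono_drift (s : ℝ) (x : Rn n) (w : Rn m) :
    ∑ i, mono w i • P.drift i s x = P.A s x + P.B s x w := by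
  rw [sum_idx, apply_eq_sum (P.B s x)]
  simp [mono, drift, Bcol]

lemma inner_eq_sum {k : ℕ} (x y : Rn k) : ⟪x, y⟫_ℝ = ∑ j, x j * y j := by
  simp [PiLp.inner_apply, mul_comm]

lemma R_apply_coord (s : ℝ) (x : Rn n) (w : Rn m) (j : Fin m) :
    P.R s x w j = ∑ k, w k * P.Rent j k s x := by
  rw [apply_eq_sum (P.R s x)]
  simp [Rent]

lemma sum_mono_lagrangian (s : ℝ) (x : Rn n) (u : ℝ → Rn m) (X : ℝ → Rn n) (hx : X s = x) :
    ∑ i, mono (u s) i * P.lagrangian i s x = P.runningCost u X s := by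
  rw [sum_idx, runningCost, inner_eq_sum, inner_eq_sum]
  simp_rw [R_apply_coord]
  simp only [mono, lagrangian, Sum.elim_inl, Sum.elim_inr, hx, one_mul, Finset.sum_mul,
    Finset.mul_sum]
  rw [← add_assoc]
  congr 1
  · congr 1
    exact Finset.sum_congr rfl fun j _ => mul_comm _ _
  · exact Finset.sum_congr rfl fun j _ => Finset.sum_congr rfl fun k _ => by ring

lemma adjoint_add_sum {k l : ℕ} {ι : Type*} [Fintype ι] (M : Rn k →L[ℝ] Rn l) (a : ι → ℝ)
    (N : ι → Rn k →L[ℝ] Rn l) (y : Rn l) :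
    ((M + ∑ j, a j • N j)†) y = (M†) y + ∑ j, a j • ((N j)†) y := by
  rw [map_add, map_sum, add_apply, sum_apply]
  simp_rw [map_smulₛₗ, smul_apply]
  simp

lemma sum_mono_adjoint (h3 : P.H3) {s : ℝ} (hs : s ∈ Icc 0 P.T) (x y : Rn n) (w : Rn m) :
    -∑ i, mono w i • (∑ k, y k • ∇ (fun z => P.drift i s z k) x + ∇ (P.lagrangian i s) x) =
    -((fderiv ℝ (P.A s) x + ∑ j, w j • fderiv ℝ (P.Bcol j s) x)†) y
      - ∇ (P.Q s) x - ((fderiv ℝ (P.S s) x)†) w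
      - (1 / 2 : ℝ) • ∑ j, ∑ k, (w j * w k) • ∇ (P.Rent j k s) x := by
  have hd : ∀ {k : ℕ} {g : ℝ → Rn n → Rn k},
      ContDiffOn ℝ 2 (fun p : ℝ × Rn n => g p.1 p.2) (Icc 0 P.T ×ˢ univ) →
      DifferentiableAt ℝ (g s) x := fun hg =>
    (hasFDerivAt_of_contDiffOn (hg.of_le one_le_two) hs x).differentiableAt
  have hB : ∀ j, ((fderiv ℝ (P.Bcol j s) x)†) y = ∑ k, y k • ∇ (fun z => P.Bcol j s z k) x :=
    fun j => adjoint_fderiv_apply (hd (h3.smooth_Bcol j)) y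
  rw [sum_idx, adjoint_add_sum, adjoint_fderiv_apply (hd h3.smoothA),
    adjoint_fderiv_apply (hd h3.smoothS)]
  simp_rw [hB]
  simp only [mono, drift, lagrangian, Sum.elim_inl, Sum.elim_inr, one_smul, PiLp.zero_apply,
    smul_add, Finset.sum_add_distrib, Finset.smul_sum, smul_smul, ← mul_assoc, one_mul, gradient_fun_const,
    smul_zero, Finset.sum_const_zero, zero_add, neg_add]
  abel

lemma sum_fwdLin (s : ℝ) (u : ℝ → Rn m) (X : ℝ → Rn n) (x₁ : Rn n) (z : Rn m) :
    ∑ i, mono (u s) i • fderiv ℝ (P.drift i s) (X s) x₁ +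
      ∑ i, monoDeriv (u s) z i • P.drift i s (X s) = P.coefA u X s x₁ + P.B s (X s) z := by
  rw [sum_idx, sum_idx, apply_eq_sum (P.B s (X s)), coefA]
  simp [mono, monoDeriv, drift, Bcol, sum_apply]

lemma sum_bwdLin (h2 : P.H2) (h3 : P.H3) {s : ℝ} (hs : s ∈ Icc 0 P.T) (u : ℝ → Rn m)
    (X Y : ℝ → Rn n) (x₁ y₁ : Rn n) (z : Rn m) :
    -(∑ i, mono (u s) i • (∑ k, (Y s k • hess (fun y => P.drift i s y k) (X s) x₁ +
          y₁ k • ∇ (fun y => P.drift i s y k) (X s)) + hess (P.lagrangian i s) (X s) x₁) +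
        ∑ i, monoDeriv (u s) z i • (∑ k, Y s k • ∇ (fun y => P.drift i s y k) (X s) +
          ∇ (P.lagrangian i s) (X s))) =
    -P.coefA₁ u X Y s x₁ - ((P.coefA u X s)†) y₁ - ((P.coefC u X Y s)†) z := by
  have hd : ∀ {k : ℕ} {g : ℝ → Rn n → Rn k},
      ContDiffOn ℝ 2 (fun p : ℝ × Rn n => g p.1 p.2) (Icc 0 P.T ×ˢ univ) →
      DifferentiableAt ℝ (g s) (X s) := fun hg =>
    (hasFDerivAt_of_contDiffOn (hg.of_le one_le_two) hs (X s)).differentiableAt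
  have hB : ∀ j, ((fderiv ℝ (P.Bcol j s) (X s))†) y₁ =
      ∑ k, y₁ k • ∇ (fun z => P.Bcol j s z k) (X s) :=
    fun j => adjoint_fderiv_apply (hd (h3.smooth_Bcol j)) y₁
  have hC : ((P.coefC u X Y s)†) z =
      ∑ j, ∑ k, (u s j * z k) • ∇ (P.Rent j k s) (X s) +
      ∑ j, z j • ∇ (fun y => P.S s y j) (X s) +
      ∑ j, ∑ k, (z j * Y s k) • ∇ (fun y => P.Bcol j s y k) (X s) := by
    have h1 : ∀ j, ((fderiv ℝ (P.Rcol j s) (X s))†) z = ∑ k, z k • ∇ (P.Rent j k s) (X s) := by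
      intro j
      rw [adjoint_fderiv_apply (hd (h3.smooth_Rcol j))]
      refine Finset.sum_congr rfl fun k _ => ?_
      rw [Rent_symm h2 hs j k]
      rfl
    have h4 : ∀ k, ((fderiv ℝ (P.Brow k s) (X s))†) z =
        ∑ j, z j • ∇ (fun y => P.Bcol j s y k) (X s) := by
      intro k
      rw [adjoint_fderiv_apply (hd (h3.smooth_Brow k))]
      simp_rw [Brow_coord]
    rw [coefC, adjoint_add_sum, add_comm (∑ j, _ • _), adjoint_add_sum,
      adjoint_fderiv_apply (hd h3.smoothS)]
    simp_rw [h1, h4, Finset.smul_sum, smul_smul]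
    rw [Finset.sum_comm (f := fun k j => (Y s k * z j) • ∇ (fun y => P.Bcol j s y k) (X s))]
    simp_rw [mul_comm (Y s _)]
    abel
  have hA₁ : P.coefA₁ u X Y s x₁ = ∑ i, Y s i • hess (fun y => P.A s y i) (X s) x₁
      + hess (P.Q s) (X s) x₁
      + (1 / 2 : ℝ) • ∑ j, ∑ k, (u s j * u s k) • hess (P.Rent j k s) (X s) x₁
      + ∑ j, u s j • (∑ i, Y s i • hess (fun y => P.Bcol j s y i) (X s) x₁
        + hess (fun y => P.S s y j) (X s) x₁) := by
    simp [coefA₁, sum_apply]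
  have hh0 : hess (fun _ : Rn n => (0 : ℝ)) (X s) = 0 := by
    simp [hess, gradient_fun_const]
  -- The product rule on `u^j u^k / 2` gives two terms, which coincide after summation against the
  -- symmetric `R`.
  have hsymm : ∑ j, ∑ k, (1 / 2 * (u s j * z k + z j * u s k)) • ∇ (P.Rent j k s) (X s) =
      ∑ j, ∑ k, (u s j * z k) • ∇ (P.Rent j k s) (X s) := by
    have h5 : ∑ j, ∑ k, (z j * u s k) • ∇ (P.Rent j k s) (X s) =
        ∑ j, ∑ k, (u s j * z k) • ∇ (P.Rent j k s) (X s) := by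
      rw [Finset.sum_comm]
      refine Finset.sum_congr rfl fun j _ => Finset.sum_congr rfl fun k _ => ?_
      rw [Rent_symm h2 hs j k, mul_comm]
    simp_rw [mul_smul (1 / 2 : ℝ), ← Finset.smul_sum, add_smul, Finset.sum_add_distrib]
    rw [h5, ← two_smul ℝ (∑ j, _), smul_smul]
    norm_num
  rw [sum_idx, sum_idx, hC, hA₁, coefA, adjoint_add_sum, adjoint_fderiv_apply (hd h3.smoothA)]
  simp_rw [hB]
  simp only [mono, monoDeriv, drift, lagrangian, Sum.elim_inl, Sum.elim_inr, one_smul,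
    zero_smul, PiLp.zero_apply, gradient_fun_const, hh0, zero_apply, smul_zero,
    Finset.sum_const_zero, zero_add, add_zero, hsymm]
  simp only [smul_add, Finset.sum_add_distrib, Finset.smul_sum, smul_smul]
  abel

/-- The left side is the derivative in the control of the Hamiltonian `Q + ⟪S, u⟫ + ⟪R u, u⟫ / 2 +
⟪A + B u, y⟫`; this is where the gradient formula comes from. -/
lemma sum_monoDeriv_inner (h2 : P.H2) {s : ℝ} (hs : s ∈ Icc 0 P.T) (x y : Rn n) (w z : Rn m) :
    ∑ i, monoDeriv w z i * (P.lagrangian i s x + ⟪P.drift i s x, y⟫_ℝ) =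
      ⟪P.R s x w + P.S s x + ((P.B s x)†) y, z⟫_ℝ := by
  rw [inner_add_left, inner_add_left, ContinuousLinearMap.adjoint_inner_left, real_inner_comm,
    real_inner_comm _ y, inner_eq_sum _ (P.R s x w), inner_eq_sum (P.S s x),
    apply_eq_sum (P.B s x) z, sum_inner, sum_idx]
  simp_rw [R_apply_coord, real_inner_smul_left, Finset.mul_sum]
  have h5 : ∑ j, ∑ k, w j * z k * P.Rent j k s x = ∑ j, ∑ k, z j * w k * P.Rent j k s x := by
    rw [Finset.sum_comm]
    refine Finset.sum_congr rfl fun j _ => Finset.sum_congr rfl fun k _ => ?_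
    rw [Rent_symm h2 hs j k, mul_comm (w k)]
  simp only [monoDeriv, lagrangian, drift, Sum.elim_inl, Sum.elim_inr, zero_mul, inner_zero_left,
    add_zero, zero_add, mul_add, add_mul, Finset.sum_add_distrib, mul_assoc,
    ← Finset.mul_sum]
  simp only [mul_assoc, ← Finset.mul_sum] at h5
  simp only [h5, mul_comm (P.S s x _), Bcol]
  ring

lemma B_adjoint_apply (s : ℝ) (x y : Rn n) :
    ((P.B s x)†) y = ∑ i, y i • P.Brow i s x :=
  apply_eq_sum _ y

end PointwiseIdentities

lemma eventually_mem_horizon {t : ℝ} (ht : t ∈ Icc 0 P.T) :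
    ∀ᵐ s ∂volume.restrict (Icc t P.T), s ∈ Icc t P.T ∧ s ∈ Icc 0 P.T := by
  filter_upwards [ae_restrict_mem measurableSet_Icc] with s hs
  exact ⟨hs, ht.1.trans hs.1, hs.2⟩

/-! ### State, adjoint state and gradient of the cost. -/

section Solutions

variable (hT : 0 < P.T) (h1 : P.H1) (h3 : P.H3) {t : ℝ} (ht : t ∈ Icc 0 P.T)
  [hfact : Fact (t ≤ P.T)]

lemma coeFn_fwd_eq (u : Control m t P.T) (X : C(Icc t P.T, Rn n)) :
    (toSystem hT h1 h3 ht).fwd (mult u) X =ᵐ[volume.restrict (Icc t P.T)]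
      fun s => P.A s (ext X s) + P.B s (ext X s) (u s) := by
  filter_upwards [(toSystem hT h1 h3 ht).coeFn_fwd (mult u) X, coeFn_mult u] with s h4 h5
  rw [h4]
  simp_rw [h5]
  exact sum_mono_drift s _ _

/-- The state trajectory of a control. -/
noncomputable def trajectory (x : Rn n) (u : Control m t P.T) : C(Icc t P.T, Rn n) :=
  (toSystem hT h1 h3 ht).traj x (mult u)

/-- The adjoint trajectory of a control. -/
noncomputable def costate (x : Rn n) (u : Control m t P.T) : C(Icc t P.T, Rn n) :=
  (toSystem hT h1 h3 ht).adj x (mult u)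

lemma isState_trajectory (x : Rn n) (u : Control m t P.T) :
    P.IsState t x u (ext (trajectory hT h1 h3 ht x u)) := by
  refine ⟨solvesODE_ext ((toSystem hT h1 h3 ht).traj_eq x (mult u)) ?_, ?_⟩
  · exact coeFn_fwd_eq hT h1 h3 ht u _
  · exact (ext_of_mem _ (left_mem_Icc.2 hfact.out)).trans
      ((toSystem hT h1 h3 ht).traj_left x (mult u))

lemma eqOn_trajectory {x : Rn n} {u : Control m t P.T} {X : ℝ → Rn n} (h : P.IsState t x u X) :
    EqOn X (ext (trajectory hT h1 h3 ht x u)) (Icc t P.T) := by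
  obtain ⟨X', hX, hX'⟩ := exists_curve_of_solvesODE h.1
  have h4 := hX' ((toSystem hT h1 h3 ht).fwd (mult u) X') (by
    filter_upwards [coeFn_fwd_eq hT h1 h3 ht u X', eventually_mem_horizon ht] with s h5 hs
    rw [h5, hX hs.1]) left
  have h5 : X' left = x := by
    rw [← h.2, hX (left_mem_Icc.2 hfact.out)]
    exact (ext_coe X' left).symm
  rw [h5] at h4
  rw [trajectory, ← (toSystem hT h1 h3 ht).eq_traj h4]
  exact hX

/-- `state` is an arbitrarily chosen solution; uniqueness fixes it on `[t, T]`, which is all that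
the cost sees. -/
lemma eqOn_state (x : Rn n) (u : Control m t P.T) :
    EqOn (P.state t x u) (ext (trajectory hT h1 h3 ht x u)) (Icc t P.T) := by
  have hex : ∃ X, P.IsState t x u X := ⟨_, isState_trajectory hT h1 h3 ht x u⟩
  rw [state, dif_pos hex]
  exact eqOn_trajectory hT h1 h3 ht hex.choose_spec

lemma coeFn_sum_lagrangian (u : Control m t P.T) (X : C(Icc t P.T, Rn n)) :
    (fun s => ∑ i, mult u i s • ext (((toSystem hT h1 h3 ht).isC1_c i).nem X) s)
      =ᵐ[volume.restrict (Icc t P.T)] P.runningCost u (ext X) := by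
  filter_upwards [coeFn_mult u, eventually_mem_horizon ht] with s h4 hs
  simp_rw [h4, ext_of_mem _ hs.1]
  refine (sum_mono_lagrangian s (X ⟨s, hs.1⟩) u (ext X) (ext_of_mem _ hs.1)).symm ▸ ?_
  rfl

lemma intervalIntegrable_runningCost (hT : 0 < P.T) (h1 : P.H1) (h3 : P.H3) {t : ℝ}
    (ht : t ∈ Icc 0 P.T) [Fact (t ≤ P.T)] (u : Control m t P.T) (X : C(Icc t P.T, Rn n)) :
    IntervalIntegrable (P.runningCost u (ext X)) volume t P.T :=
  intervalIntegrable_of_integrable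
    ((integrable_sum_mul _ (mult u)).congr (coeFn_sum_lagrangian hT h1 h3 ht u X)) left right

lemma J_eq_cost (x : Rn n) (u : Control m t P.T) :
    P.J t x u = (toSystem hT h1 h3 ht).cost x (mult u) := by
  have hs := eqOn_state hT h1 h3 ht x u
  have hT' : P.T ∈ Icc t P.T := right_mem_Icc.2 hfact.out
  rw [J, System.cost, prim_sum_mulLp, hs hT', ext_of_mem _ hT']
  congr 1
  rw [intervalIntegral_congr_of_ae (coeFn_sum_lagrangian hT h1 h3 ht u
    ((toSystem hT h1 h3 ht).traj x (mult u)))]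
  refine intervalIntegral.integral_congr fun s hs' => ?_
  rw [uIcc_of_le hfact.out] at hs'
  simp only [runningCost, hs hs']
  rfl

lemma coeFn_bwd_eq (u : Control m t P.T) (X Y : C(Icc t P.T, Rn n)) :
    (toSystem hT h1 h3 ht).bwd (mult u) X Y =ᵐ[volume.restrict (Icc t P.T)] fun s =>
      -((fderiv ℝ (P.A s) (ext X s) + ∑ j, u s j • fderiv ℝ (P.Bcol j s) (ext X s))†) (ext Y s)
      - ∇ (P.Q s) (ext X s) - ((fderiv ℝ (P.S s) (ext X s))†) (u s)
      - (1 / 2 : ℝ) • ∑ j, ∑ k, (u s j * u s k) • ∇ (P.Rent j k s) (ext X s) := by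
  filter_upwards [(toSystem hT h1 h3 ht).coeFn_bwd (mult u) X Y, coeFn_mult u,
    eventually_mem_horizon ht] with s h4 h5 hs
  rw [h4]
  simp_rw [h5]
  exact sum_mono_adjoint h3 hs.2 _ _ _

lemma isStateAdjoint (x : Rn n) (u : Control m t P.T) :
    P.IsStateAdjoint t x u (ext (trajectory hT h1 h3 ht x u)) (ext (costate hT h1 h3 ht x u)) := by
  refine ⟨isState_trajectory hT h1 h3 ht x u,
    solvesODE_ext ((toSystem hT h1 h3 ht).adj_eq x (mult u)) (coeFn_bwd_eq hT h1 h3 ht u _ _), ?_⟩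
  have hT' : P.T ∈ Icc t P.T := right_mem_Icc.2 hfact.out
  rw [ext_of_mem _ hT', ext_of_mem _ hT', costate, System.adj_eq, ContinuousMap.add_apply]
  have : prim right ((toSystem hT h1 h3 ht).bwd (mult u) ((toSystem hT h1 h3 ht).traj x (mult u))
      ((toSystem hT h1 h3 ht).adj x (mult u))) ⟨P.T, hT'⟩ = 0 :=
    intervalIntegral.integral_same
  rw [this, add_zero]
  rfl

lemma eqOn_costate {x : Rn n} {u : Control m t P.T} {X Y : ℝ → Rn n}
    (h : P.IsStateAdjoint t x u X Y) :
    EqOn X (ext (trajectory hT h1 h3 ht x u)) (Icc t P.T) ∧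
      EqOn Y (ext (costate hT h1 h3 ht x u)) (Icc t P.T) := by
  have hX := eqOn_trajectory hT h1 h3 ht h.state
  have hT' : P.T ∈ Icc t P.T := right_mem_Icc.2 hfact.out
  refine ⟨hX, ?_⟩
  obtain ⟨Y', hY, hY'⟩ := exists_curve_of_solvesODE h.adjoint
  have h4 := hY' ((toSystem hT h1 h3 ht).bwd (mult u) (trajectory hT h1 h3 ht x u) Y') (by
    filter_upwards [coeFn_bwd_eq hT h1 h3 ht u (trajectory hT h1 h3 ht x u) Y',
      eventually_mem_horizon ht] with s h5 hs
    rw [h5, hX hs.1, hY hs.1]) right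
  have h5 : Y' right = ∇ P.G (trajectory hT h1 h3 ht x u right) := by
    have h6 := h.terminal
    rw [hY hT', hX hT', ext_of_mem _ hT', ext_of_mem _ hT'] at h6
    exact h6
  rw [h5] at h4
  rw [costate, ← (toSystem hT h1 h3 ht).eq_adj h4]
  exact hY

/-- The gradient of the cost, in terms of state and adjoint state. -/
noncomputable def costGradient (x : Rn n) (u : Control m t P.T) : Control m t P.T :=
  toLpC 2 ((isC1_of_contDiffOn hT ht (h3.smoothS.of_le one_le_two)).nem
      (trajectory hT h1 h3 ht x u) +
    ∑ i, smulC (System.coordC i (costate hT h1 h3 ht x u))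
      ((isC1_of_contDiffOn hT ht ((h3.smooth_Brow i).of_le one_le_two)).nem
        (trajectory hT h1 h3 ht x u))) +
  ∑ j, mulLp 2 ((isC1_of_contDiffOn hT ht ((h3.smooth_Rcol j).of_le one_le_two)).nem
    (trajectory hT h1 h3 ht x u)) (coordL2 j u)

/-- `costGradient` expands `R u` in columns of `R` and `Bᵀ Y` in rows of `B`. The control thus
enters through scalar `L²` factors of continuous curves, so that the sum is in `L²` by construction
and accessible to the product rule. -/
lemma coeFn_costGradient (x : Rn n) (u : Control m t P.T) :
    costGradient hT h1 h3 ht x u =ᵐ[volume.restrict (Icc t P.T)] fun s =>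
      P.R s (ext (trajectory hT h1 h3 ht x u) s) (u s) +
        P.S s (ext (trajectory hT h1 h3 ht x u) s) +
        ((P.B s (ext (trajectory hT h1 h3 ht x u) s))†) (ext (costate hT h1 h3 ht x u) s) := by
  rw [costGradient]
  set X := trajectory hT h1 h3 ht x u
  set Y := costate hT h1 h3 ht x u
  have hc : ∀ᵐ s ∂volume.restrict (Icc t P.T), ∀ j, coordL2 j u s = u s j :=
    ae_all_iff.2 fun j => coeFn_coordL2 j u
  refine (Lp.coeFn_add _ _).trans ?_
  filter_upwards [coeFn_toLpC 2 ((isC1_of_contDiffOn hT ht (h3.smoothS.of_le one_le_two)).nem X +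
      ∑ i, smulC (System.coordC i Y)
      ((isC1_of_contDiffOn hT ht ((h3.smooth_Brow i).of_le one_le_two)).nem X)),
    coeFn_sum_mulLp 2 (fun j => (isC1_of_contDiffOn hT ht
      ((h3.smooth_Rcol j).of_le one_le_two)).nem X) (fun j => coordL2 j u),
    hc, eventually_mem_horizon ht] with s h4 h5 h6 hs
  rw [Pi.add_apply, h4, h5]
  simp_rw [h6, ext_of_mem _ hs.1]
  rw [B_adjoint_apply, apply_eq_sum (P.R s _)]
  simp only [ContinuousMap.add_apply, ContinuousMap.sum_apply, IsC1.nem_apply, ptw_apply,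
    ptwLin_apply]
  rw [add_comm, add_assoc]
  rfl

/-- The chain rule through the multipliers gives the derivative as an integral, which
`sum_monoDeriv_inner` turns into an `L²` inner product with `v`. -/
lemma hasGradientAt_J (h2 : P.H2) (x : Rn n) (u : Control m t P.T) :
    HasGradientAt (P.J t x) (costGradient hT h1 h3 ht x u) u := by
  obtain ⟨D, hD, hD'⟩ := (toSystem hT h1 h3 ht).exists_hasStrictFDerivAt_cost x (mult u)
  obtain ⟨M, hM, hM'⟩ := exists_hasStrictFDerivAt_mult u
  have h4 : P.J t x = (toSystem hT h1 h3 ht).cost x ∘ mult :=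
    funext fun w => J_eq_cost hT h1 h3 ht x w
  rw [hasGradientAt_iff_hasFDerivAt, h4]
  refine (hD.hasFDerivAt.comp u hM.hasFDerivAt).congr_fderiv ?_
  ext v
  rw [InnerProductSpace.toDual_apply_apply, L2.inner_def, ContinuousLinearMap.comp_apply, hD']
  refine integral_congr_ae ?_
  filter_upwards [hM' v, coeFn_costGradient hT h1 h3 ht x u, eventually_mem_horizon ht]
    with s h5 h6 hs
  rw [h6]
  simp_rw [h5]
  exact sum_monoDeriv_inner h2 hs.2 _ _ _ _

lemma coeFn_fwdLin_eq (u v : Control m t P.T) (X X₁ : C(Icc t P.T, Rn n))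
    {δ : System.Mult t P.T (Idx m)}
    (hδ : ∀ᵐ s ∂volume.restrict (Icc t P.T), ∀ i, δ i s = monoDeriv (u s) (v s) i) :
    (toSystem hT h1 h3 ht).fwdLin (mult u) X δ X₁ =ᵐ[volume.restrict (Icc t P.T)]
      fun s => P.coefA u (ext X) s (ext X₁ s) + P.B s (ext X s) (v s) := by
  filter_upwards [(toSystem hT h1 h3 ht).coeFn_fwdLin (mult u) X δ X₁, coeFn_mult u, hδ]
    with s h4 h5 h6
  rw [h4]
  simp_rw [h5, h6]
  exact sum_fwdLin s u (ext X) _ _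

lemma coeFn_bwdLin_eq (h2 : P.H2) (u v : Control m t P.T) (X Y X₁ Y₁ : C(Icc t P.T, Rn n))
    {δ : System.Mult t P.T (Idx m)}
    (hδ : ∀ᵐ s ∂volume.restrict (Icc t P.T), ∀ i, δ i s = monoDeriv (u s) (v s) i) :
    (toSystem hT h1 h3 ht).bwdLin (mult u) X Y δ X₁ Y₁ =ᵐ[volume.restrict (Icc t P.T)]
      fun s => -P.coefA₁ u (ext X) (ext Y) s (ext X₁ s) - ((P.coefA u (ext X) s)†) (ext Y₁ s)
        - ((P.coefC u (ext X) (ext Y) s)†) (v s) := by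
  filter_upwards [(toSystem hT h1 h3 ht).coeFn_bwdLin (mult u) X Y δ X₁ Y₁, coeFn_mult u, hδ,
    eventually_mem_horizon ht] with s h4 h5 h6 hs
  rw [h4]
  simp_rw [h5, h6]
  exact sum_bwdLin h2 h3 hs.2 u (ext X) (ext Y) _ _ _

end Solutions

/-! ### Derivative of the gradient and the linearized system. -/

section SecondDerivative

variable (hT : 0 < P.T) (h1 : P.H1) (h3 : P.H3) {t : ℝ}
  (ht : t ∈ Icc 0 P.T) [hfact : Fact (t ≤ P.T)]

lemma proj_curve_apply {T : ℝ} (k : Fin n) (X : C(Icc t T, Rn n)) (s : Icc t T) :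
    (EuclideanSpace.proj k : Rn n →L[ℝ] ℝ) (X s) = X s k := rfl

lemma exists_hasStrictFDerivAt_sum_smul_nem {W F : Type*} [NormedAddCommGroup W] [NormedSpace ℝ W]
    [NormedAddCommGroup F] [NormedSpace ℝ F] {T : ℝ} {g : ℝ → Rn n → F} {b : Fin n → ℝ → Rn n → F}
    (hg : IsC1 t T g) (hb : ∀ i, IsC1 t T (b i)) {X Y : W → C(Icc t T, Rn n)}
    {K N : W →L[ℝ] C(Icc t T, Rn n)} {u : W} (hK : HasStrictFDerivAt X K u)
    (hN : HasStrictFDerivAt Y N u) :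
    ∃ D : W →L[ℝ] C(Icc t T, F),
      HasStrictFDerivAt (fun w => hg.nem (X w) +
        ∑ i, smulC (System.coordC i (Y w)) ((hb i).nem (X w))) D u ∧
      ∀ v, D v = app (hg.nemDeriv (X u)) (K v) + ∑ i, (smulC (System.coordC i (Y u))
          (app ((hb i).nemDeriv (X u)) (K v)) +
            smulC (System.coordC i (N v)) ((hb i).nem (X u))) := by
  refine ⟨_, ((hg.hasStrictFDerivAt_nem (X u)).comp u hK).add
    (hasStrictFDerivAt_sum_bilin (smulC (K := Icc t T) (F := F))
      (fun i => (System.coordC (t := t) (T := T) (n := n) i).hasStrictFDerivAt.comp u hN)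
      (fun i => ((hb i).hasStrictFDerivAt_nem (X u)).comp u hK)), fun v => ?_⟩
  rw [add_apply, sum_apply]
  rfl

lemma exists_hasStrictFDerivAt_sum_mulLp_nem {W F : Type*} [NormedAddCommGroup W]
    [NormedSpace ℝ W] [NormedAddCommGroup F] [NormedSpace ℝ F] {T : ℝ} [Fact (t ≤ T)]
    {ι : Type*} [Fintype ι] (p : ENNReal) [Fact (1 ≤ p)] {r : ι → ℝ → Rn n → F}
    (hr : ∀ j, IsC1 t T (r j)) {X : W → C(Icc t T, Rn n)}
    {K : W →L[ℝ] C(Icc t T, Rn n)} {u : W} (hK : HasStrictFDerivAt X K u)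
    (l : ι → W →L[ℝ] Lp ℝ p (volume.restrict (Icc t T))) :
    ∃ D : W →L[ℝ] Lp F p (volume.restrict (Icc t T)),
      HasStrictFDerivAt (fun w => ∑ j, mulLp p ((hr j).nem (X w)) (l j w)) D u ∧
      ∀ v, D v = ∑ j, mulLp p ((hr j).nem (X u)) (l j v) +
        ∑ j, mulLp p (app ((hr j).nemDeriv (X u)) (K v)) (l j u) := by
  refine ⟨_, hasStrictFDerivAt_sum_bilin (mulLp (t := t) (T := T) (E := F) p)
      (fun j => ((hr j).hasStrictFDerivAt_nem (X u)).comp u hK)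
      (fun j => (l j).hasStrictFDerivAt), fun v => ?_⟩
  rw [sum_apply, ← Finset.sum_add_distrib]
  rfl

/-- The variation of the state acts on `R u`, `S` and `Bᵀ Y` through their `x`-derivatives, and
these add up to `coefC`. The variations of the control and of the adjoint state give the two other
terms. -/
lemma exists_hasStrictFDerivAt_costGradient (x : Rn n) (u : Control m t P.T)
    {K N : Control m t P.T →L[ℝ] C(Icc t P.T, Rn n)}
    (hK : HasStrictFDerivAt (trajectory hT h1 h3 ht x) K u)
    (hN : HasStrictFDerivAt (costate hT h1 h3 ht x) N u) :
    ∃ D : Control m t P.T →L[ℝ] Control m t P.T,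
      HasStrictFDerivAt (costGradient hT h1 h3 ht x) D u ∧
      ∀ v, ∀ᵐ s ∂volume.restrict (Icc t P.T),
        D v s = P.R s (ext (trajectory hT h1 h3 ht x u) s) (v s)
          + ((P.B s (ext (trajectory hT h1 h3 ht x u) s))†) (ext (N v) s)
          + P.coefC u (ext (trajectory hT h1 h3 ht x u)) (ext (costate hT h1 h3 ht x u)) s
            (ext (K v) s) := by
  have hS := isC1_of_contDiffOn hT ht (h3.smoothS.of_le one_le_two)
  have hB := fun i => isC1_of_contDiffOn hT ht ((h3.smooth_Brow i).of_le one_le_two)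
  have hR := fun j => isC1_of_contDiffOn hT ht ((h3.smooth_Rcol j).of_le one_le_two)
  obtain ⟨D₁, hD₁, hD₁'⟩ := exists_hasStrictFDerivAt_sum_smul_nem hS hB hK hN
  obtain ⟨D₂, hD₂, hD₂'⟩ := exists_hasStrictFDerivAt_sum_mulLp_nem 2 hR hK coordL2
  have hD₃ := (toLpC (t := t) (T := P.T) (E := Rn m) 2).hasStrictFDerivAt.comp u hD₁
  refine ⟨(toLpC 2).comp D₁ + D₂, hD₃.add hD₂, fun v => ?_⟩
  have hcu : ∀ᵐ s ∂volume.restrict (Icc t P.T), ∀ j, coordL2 j u s = u s j :=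
    ae_all_iff.2 fun j => coeFn_coordL2 j u
  have hcv : ∀ᵐ s ∂volume.restrict (Icc t P.T), ∀ j, coordL2 j v s = v s j :=
    ae_all_iff.2 fun j => coeFn_coordL2 j v
  rw [add_apply, ContinuousLinearMap.comp_apply, hD₂']
  filter_upwards [Lp.coeFn_add (toLpC 2 (D₁ v)) (∑ j, mulLp 2 ((hR j).nem (trajectory hT h1 h3 ht x u)) (coordL2 j v) +
      ∑ j, mulLp 2 (app ((hR j).nemDeriv (trajectory hT h1 h3 ht x u)) (K v)) (coordL2 j u)),
    Lp.coeFn_add (∑ j, mulLp 2 ((hR j).nem (trajectory hT h1 h3 ht x u)) (coordL2 j v))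
      (∑ j, mulLp 2 (app ((hR j).nemDeriv (trajectory hT h1 h3 ht x u)) (K v)) (coordL2 j u)),
    coeFn_toLpC 2 (D₁ v), coeFn_sum_mulLp 2 (fun j => (hR j).nem (trajectory hT h1 h3 ht x u)) (fun j => coordL2 j v),
    coeFn_sum_mulLp 2 (fun j => app ((hR j).nemDeriv (trajectory hT h1 h3 ht x u)) (K v)) (fun j => coordL2 j u), hcu, hcv,
    eventually_mem_horizon ht] with s h4 h5 h6 h7 h8 h9 h10 hs
  rw [h4, Pi.add_apply, h5, Pi.add_apply, h6, h7, h8, hD₁']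
  simp_rw [h9, h10, coefC, ext_of_mem _ hs.1]
  rw [B_adjoint_apply, apply_eq_sum (P.R s _)]
  simp only [ContinuousMap.add_apply, ContinuousMap.sum_apply, IsC1.nem_apply,
    IsC1.nemDeriv_apply, ptw_apply, ptwLin_apply, add_apply, sum_apply, smul_apply,
    Finset.sum_add_distrib, ContinuousLinearMap.id_apply, ContinuousLinearMap.lsmul_apply,
    proj_curve_apply]
  simp only [Rcol]
  abel

/-- The two equivalences on fixed points carry existence in one direction and uniqueness in the
other. The forward equation comes first, since its solution is an input of the backward one. -/
lemma isLinearized_iff (h2 : P.H2) (x : Rn n) (u v : Control m t P.T)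
    {X₁ Y₁ : C(Icc t P.T, Rn n)} {δ : System.Mult t P.T (Idx m)}
    (hδ : ∀ᵐ s ∂volume.restrict (Icc t P.T), ∀ i, δ i s = monoDeriv (u s) (v s) i)
    (hX₁ : ∀ Z, Z = prim left ((toSystem hT h1 h3 ht).fwdLin (mult u)
      (trajectory hT h1 h3 ht x u) δ Z) ↔ Z = X₁)
    (hY₁ : ∀ Z, Z = constC (hess P.G (trajectory hT h1 h3 ht x u right) (X₁ right)) +
      prim right ((toSystem hT h1 h3 ht).bwdLin (mult u) (trajectory hT h1 h3 ht x u)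
        (costate hT h1 h3 ht x u) δ X₁ Z) ↔ Z = Y₁) :
    P.IsLinearized t u (ext (trajectory hT h1 h3 ht x u)) (ext (costate hT h1 h3 ht x u)) v
      (ext X₁) (ext Y₁) ∧
    ∀ X' Y' : ℝ → Rn n, P.IsLinearized t u (ext (trajectory hT h1 h3 ht x u))
      (ext (costate hT h1 h3 ht x u)) v X' Y' →
      EqOn X' (ext X₁) (Icc t P.T) ∧ EqOn Y' (ext Y₁) (Icc t P.T) := by
  set X := trajectory hT h1 h3 ht x u
  set Y := costate hT h1 h3 ht x u
  have ht' : t ∈ Icc t P.T := left_mem_Icc.2 hfact.out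
  have hT' : P.T ∈ Icc t P.T := right_mem_Icc.2 hfact.out
  have eX := (hX₁ X₁).2 rfl
  have eY := (hY₁ Y₁).2 rfl
  refine ⟨⟨?_, ?_, ?_, ?_⟩, fun X' Y' h => ?_⟩
  · refine solvesODE_ext (e := 0) (a := left) ?_ (coeFn_fwdLin_eq hT h1 h3 ht u v X X₁ hδ)
    rw [map_zero, zero_add]
    exact eX
  · exact solvesODE_ext eY (coeFn_bwdLin_eq hT h1 h3 ht h2 u v X Y X₁ Y₁ hδ)
  · rw [ext_of_mem _ ht', eX]
    exact intervalIntegral.integral_same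
  · rw [ext_of_mem _ hT', ext_of_mem _ hT', ext_of_mem _ hT', eY, ContinuousMap.add_apply]
    refine (congrArg _ (show prim right _ _ = _ from intervalIntegral.integral_same)).trans ?_
    rw [add_zero]
    rfl
  · obtain ⟨X'', hX, hX'⟩ := exists_curve_of_solvesODE h.forward
    have h4 := hX' ((toSystem hT h1 h3 ht).fwdLin (mult u) X δ X'') (by
      filter_upwards [coeFn_fwdLin_eq hT h1 h3 ht u v X X'' hδ, eventually_mem_horizon ht]
        with s h5 hs
      rw [h5, hX hs.1]) left
    have h5 : X'' left = 0 := by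
      rw [← h.initial, hX ht']
      exact (ext_coe X'' left).symm
    rw [h5, map_zero, zero_add] at h4
    have h6 := (hX₁ _).1 h4
    rw [h6] at hX
    refine ⟨hX, ?_⟩
    obtain ⟨Y'', hY, hY'⟩ := exists_curve_of_solvesODE h.backward
    have h7 := hY' ((toSystem hT h1 h3 ht).bwdLin (mult u) X Y δ X₁ Y'') (by
      filter_upwards [coeFn_bwdLin_eq hT h1 h3 ht h2 u v X Y X₁ Y'' hδ, eventually_mem_horizon ht]
        with s h5 hs
      rw [h5, hX hs.1, hY hs.1]) right
    have h8 : Y'' right = hess P.G (X right) (X₁ right) := by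
      have h9 := h.terminal
      rw [hY hT', hX hT', ext_of_mem _ hT', ext_of_mem _ hT', ext_of_mem _ hT'] at h9
      exact h9
    rw [h8] at h7
    have h9 := (hY₁ _).1 h7
    rw [h9] at hY
    exact hY

end SecondDerivative

end AQProblem

theorem proposition4p1 {n m : ℕ} (P : AQProblem n m) (hT : 0 < P.T)
    (h1 : P.H1) (h2 : P.H2) (h3 : P.H3)
    (t : ℝ) (ht : t ∈ Icc 0 P.T) (x : Rn n) (u : Control m t P.T) :
    ∃ X Y : ℝ → Rn n,
      P.IsStateAdjoint t x u X Y ∧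
      (∀ X' Y' : ℝ → Rn n, P.IsStateAdjoint t x u X' Y' →
        EqOn X' X (Icc t P.T) ∧ EqOn Y' Y (Icc t P.T)) ∧
      IntervalIntegrable (P.runningCost u X) volume t P.T ∧
      DifferentiableAt ℝ (P.J t x) u ∧
      (∀ᵐ s ∂volume.restrict (Icc t P.T),
        P.DuJ t x u s = P.R s (X s) (u s) + P.S s (X s) + ((P.B s (X s))†) (Y s)) ∧
      DifferentiableAt ℝ (P.DuJ t x) u ∧
      ∀ v : Control m t P.T, ∃ X₁ Y₁ : ℝ → Rn n,
        P.IsLinearized t u X Y v X₁ Y₁ ∧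
        (∀ X₁' Y₁' : ℝ → Rn n, P.IsLinearized t u X Y v X₁' Y₁' →
          EqOn X₁' X₁ (Icc t P.T) ∧ EqOn Y₁' Y₁ (Icc t P.T)) ∧
        ∀ᵐ s ∂volume.restrict (Icc t P.T),
          P.DuuJ t x u v s = P.R s (X s) (v s) + ((P.B s (X s))†) (Y₁ s)
            + P.coefC u X Y s (X₁ s) := by
  have hfact : Fact (t ≤ P.T) := ⟨ht.2⟩
  -- An identity of functions of the control, not only at `u`, so that both sides have the same
  -- derivative.
  have hDuJ : P.DuJ t x = AQProblem.costGradient hT h1 h3 ht x :=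
    funext fun w => (AQProblem.hasGradientAt_J hT h1 h3 ht h2 x w).gradient
  obtain ⟨K, hK, hK'⟩ := (AQProblem.toSystem hT h1 h3 ht).exists_hasStrictFDerivAt_traj x
    (CurveSpace.mult u)
  obtain ⟨N, hN, hN'⟩ := (AQProblem.toSystem hT h1 h3 ht).exists_hasStrictFDerivAt_adj x
    (CurveSpace.mult u) hK
  obtain ⟨M, hM, hM'⟩ := CurveSpace.exists_hasStrictFDerivAt_mult u
  obtain ⟨D, hD, hD'⟩ := AQProblem.exists_hasStrictFDerivAt_costGradient hT h1 h3 ht x u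
    (hK.comp u hM) (hN.comp u hM)
  refine ⟨CurveSpace.ext (AQProblem.trajectory hT h1 h3 ht x u),
    CurveSpace.ext (AQProblem.costate hT h1 h3 ht x u),
    AQProblem.isStateAdjoint hT h1 h3 ht x u, fun X' Y' h => AQProblem.eqOn_costate hT h1 h3 ht h,
    AQProblem.intervalIntegrable_runningCost hT h1 h3 ht u _,
    (AQProblem.hasGradientAt_J hT h1 h3 ht h2 x u).differentiableAt, ?_, ?_, fun v => ?_⟩
  · rw [hDuJ]
    exact AQProblem.coeFn_costGradient hT h1 h3 ht x u
  · rw [hDuJ]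
    exact hD.differentiableAt
  -- The direction `v` acts through the induced variation `M v` of the multipliers; `X₁` and `Y₁`
  -- are `K (M v)` and `N (M v)`.
  · obtain ⟨hl, hu⟩ := AQProblem.isLinearized_iff hT h1 h3 ht h2 x u v (hM' v)
      (hK' (M v)) (hN' (M v))
    refine ⟨_, _, hl, hu, ?_⟩
    rw [AQProblem.DuuJ, hDuJ, hD.hasFDerivAt.fderiv]
    exact hD' v
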